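/- **Setting.** Let $T>0$, and let $B$ be a $q$-dimensional Brownian motion on a filtered probability space. Let $X$ be a continuous adapted solution on $[0,T]$ of $dX_t=b(X_t)\,dt+\sum_{j=1}^q\sigma_j(X_t)\,dB^j_t$, $X_0=x\in\mathbb R^d$, where $b,\sigma_j:\mathbb R^d\to\mathbb R^d$ satisfy $|b(y)-b(z)|+\sum_j|\sigma_j(y)-\sigma_j(z)|\le K|y-z|$ for some $K>0$. Let $P:\mathbb R^d\to\mathbb R$ be measurable, with $\operatorname{Var}(P(X_T))>0$, and put $\mathbf J_0=\mathbb E[P(X_T)]$. **Discretization.** Let $M\ge 2$ and $m\ge1$ be integers, $\mathbf h=T/m$, $n_l=M^{l-1}$ for $l\ge1$, and $\mathcal H=\{\mathbf h/n:\ n\ge1\}$. Fix a one-step scheme given by measurable maps $\Psi_h:\mathbb R^d\times\mathbb R^q\to\mathbb R^d$ (for example the Euler scheme $\Psi_h(y,w)=y+hb(y)+\sum_j w_j\sigma_j(y)$, or, for $d=q=1$, the Milstein scheme). For a path $w$, $\theta\in\mathbb R^q$ and $h\in\mathcal H$ put $X^h_{0,\theta}(w)=x$ and $X^h_{(i+1)h,\theta}(w)=\Psi_h\big(X^h_{ih,\theta}(w),\,w_{(i+1)h}-w_{ih}+h\theta\big)$;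 write $X^{h}_T=X^h_{T,0}(B)$ and $X^{n_l}_{T,\theta}(w)=X^{\mathbf h/n_l}_{T,\theta}(w)$. Let $\mathcal J^-(w,\theta)=\exp(-\langle\theta,w\rangle-\tfrac12|\theta|^2T)$. **Weights and parameters.** Let $\alpha,\beta>0$. For $L\ge1$ let $(w_l)_{1\le l\le L}$ solve $\sum_{l=1}^L n_l^{-\alpha(i-1)}w_l=\mathbf 1_{\{i=1\}}$, $1\le i\le L$, and let $\widetilde W_l=\widetilde W_l^{(L)}=\sum_{j=l}^L w_j$. Let $V_1,\widetilde c,A>0$ be constants, and $\lambda=\sqrt{V_1/\operatorname{Var}(P(X_T))}$, $\underline C=\frac{1+M^{\beta/2}}{\sqrt{1+M^{-1}}}$, $\overline C=(1+M^{\beta/2})\sqrt{1+M^{-1}}$. For $\epsilon>0$ set $\kappa=\frac12+\frac{\log(\widetilde c^{1/\alpha}\mathbf h)}{\log M}$ and $$L(\epsilon)=\Big\lceil \kappa+\sqrt{\kappa^2+\tfrac{2\log(A/\epsilon)}{\alpha\log M}}\ \Big\rceil,$$ and, with $L=L(\epsilon)$, $$\mu_1=q^*(1+\lambda\mathbf h^{\beta/2}),\qquad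 \mu_l=q^*\lambda\mathbf h^{\beta/2}\,\underline C\,|\widetilde W_l|\,M^{-\frac{1+\beta}2(l-1)}\ (2\le l\le L),$$ where $q^*$ is such that $\sum_{l=1}^L\mu_l=1$, $$N(\epsilon)=\Big(1+\frac1{2\alpha L}\Big)\frac{\operatorname{Var}(P(X_T))\Big(1+\lambda\mathbf h^{\beta/2}+\lambda\mathbf h^{\beta/2}\,\overline C\sum_{l=2}^L|\widetilde W_l|M^{\frac{1-\beta}2(l-1)}\Big)}{\epsilon^2q^*},\qquad N_l=N_l(\epsilon)=\lceil N(\epsilon)\mu_l\rceil .$$ (For small $\epsilon$ these are well defined with $L(\epsilon)\ge 1$; only small $\epsilon$ matters.) **Estimator.** Let $(W^{l,k})_{l,k\ge1}$ be $q$-dimensional Brownian motions that are independent on $[0,T]$, let $\Theta\subset\mathbb R^q$ be compact, and for $l\ge1$, $k\ge0$ let $\theta_l^k$ be a $\Theta$-valued random variable that is measurable with respect to $\sigma(W^{l',j}_t:\ l'\ge1,\ 1\le j\le k,\ t\le T)$. The adaptive importance sampling ML2R estimator is $$\mathbf J^{N,\theta}_\pi(\epsilon)=\frac1{N_1}\sum_{k=1}^{N_1}P\big(X^{n_1}_{T,\theta_1^{k-1}}(W^{1,k})\big)\mathcal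 J^-(W^{1,k}_T,\theta_1^{k-1})+\sum_{l=2}^{L(\epsilon)}\frac{\widetilde W_l}{N_l}\sum_{k=1}^{N_l}\Big(P\big(X^{n_l}_{T,\theta_l^{k-1}}(W^{l,k})\big)-P\big(X^{n_{l-1}}_{T,\theta_l^{k-1}}(W^{l,k})\big)\Big)\mathcal J^-(W^{l,k}_T,\theta_l^{k-1}).$$ **Theorem.** Suppose that for every $l\ge 1$ there is $\theta_l^*\in\Theta$ with $\theta_l^k\to\theta_l^*$ almost surely as $k\to\infty$. Let $p\ge2$ and assume: 1. (weak error of every order) there are reals $(c_k)_{k\ge1}$ such that for every $R\ge1$ there is a function $\eta_R$ with $\eta_R(h)\to0$ as $h\to0^+$ and $\mathbb E[P(X_T^h)]-\mathbb E[P(X_T)]=\sum_{k=1}^{R}c_kh^{\alpha k}+h^{\alpha R}\eta_R(h)$ for all $h\in\mathcal H$; 2. $P(X_T)\in L^p$; 3. ($L^p$ strong error) there is $V_1^{(p)}>0$ with $\mathbb E\big[|P(X_T^h)-P(X_T)|^p\big]\le V_1^{(p)}h^{\beta p/2}$ for all $h\in\mathcal H$. Then for every sequence $(\epsilon_k)_{k\ge1}$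 of positive reals with $\sum_k\epsilon_k^p<\infty$, $\ \mathbf J^{N,\theta}_\pi(\epsilon_k)\to\mathbf J_0$ almost surely as $k\to\infty$. -/

import Mathlib

open MeasureTheory ProbabilityTheory Filter Topology
open scoped NNReal ENNReal

noncomputable section

namespace AISML2R

/-- `ℝⁿ` with its Euclidean norm. -/
abbrev E (n : ℕ) : Type := EuclideanSpace ℝ (Fin n)

/-! ### Brownian motion and the stochastic differential equation -/

section Brownian

variable {Ω : Type*} [mΩ : MeasurableSpace Ω] {d q : ℕ}

/-- Standard `q`-dimensional Brownian motion: the coordinates are independent real Brownian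
motions. -/
structure IsBrownianMotion (W : ℝ≥0 → Ω → E q) (μ : Measure Ω) : Prop where
  measurable : ∀ t, Measurable (W t)
  coord : ∀ j : Fin q, IsBrownianReal (fun t ω => W t ω j) μ
  indep : iIndepFun (fun (j : Fin q) (ω : Ω) (t : ℝ≥0) => W t ω j) μ

/-- Standard `q`-dimensional Brownian motion with respect to the filtration `𝓕`. -/
structure IsFBrownianMotion (𝓕 : Filtration ℝ≥0 mΩ) (W : ℝ≥0 → Ω → E q) (μ : Measure Ω) : Prop
    extends IsBrownianMotion W μ where
  adapted : Adapted 𝓕 W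
  indep_past : ∀ s t : ℝ≥0, s ≤ t →
    Indep (MeasurableSpace.comap (fun ω => W t ω - W s ω) inferInstance) (𝓕 s) μ

/-- The left-point Riemann sum of `∑ⱼ ∫₀ᵗ σⱼ(X_s) dBʲ_s` for the partition of `[0, t]` into `n`
intervals of equal length. -/
def itoSum (σ : Fin q → E d → E d) (B : ℝ≥0 → Ω → E q) (X : ℝ≥0 → Ω → E d)
    (t : ℝ≥0) (n : ℕ) (ω : Ω) : E d :=
  ∑ i ∈ Finset.range n, ∑ j : Fin q,
    (B ((i + 1) * (t / n)) ω j - B (i * (t / n)) ω j) • σ j (X (i * (t / n)) ω)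

/-- `X` is a continuous adapted solution on `[0, T]` of
`dX = b(X) dt + ∑ⱼ σⱼ(X) dBʲ`, `X₀ = x`.  For a continuous adapted integrand (and continuous
coefficients) the Itô integral is the limit in probability of its left-point Riemann sums along
partitions of vanishing mesh; this is how the stochastic integral is expressed here. -/
structure IsSDESolution (T : ℝ≥0) (b : E d → E d) (σ : Fin q → E d → E d) (x : E d)
    (𝓕 : Filtration ℝ≥0 mΩ) (B : ℝ≥0 → Ω → E q) (X : ℝ≥0 → Ω → E d) (μ : Measure Ω) :
    Prop where
  adapted : ∀ t ≤ T, Measurable[𝓕 t] (X t)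
  continuous : ∀ᵐ ω ∂μ, ContinuousOn (fun t => X t ω) (Set.Icc 0 T)
  initial : ∀ᵐ ω ∂μ, X 0 ω = x
  equation : ∀ t ≤ T, TendstoInMeasure μ (itoSum σ B X t) atTop
    (fun ω => X t ω - x - ∫ s in (0 : ℝ)..(t : ℝ), b (X s.toNNReal ω))

/-- The σ-algebra generated by a path up to time `T`. -/
@[reducible] def pathSigma (T : ℝ≥0) (W : ℝ≥0 → Ω → E q) : MeasurableSpace Ω :=
  ⨆ t : ℝ≥0, ⨆ _ : t ≤ T, MeasurableSpace.comap (W t) inferInstance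

/-- The σ-algebra generated, on all levels, by the first `k` sample paths (those with
numbers `0, …, k - 1`) up to time `T`. -/
@[reducible] def pastSigma (T : ℝ≥0) (W : ℕ → ℕ → ℝ≥0 → Ω → E q) (k : ℕ) : MeasurableSpace Ω :=
  ⨆ l : ℕ, ⨆ j : ℕ, ⨆ _ : j < k, pathSigma T (W l j)

end Brownian

/-! ### Discretization and importance sampling -/

section Scheme

variable {d q : ℕ}

/-- A one-step discretization scheme with one-step map `Ψ h y w` (`h` step size, `y` present state,
`w` increment of the driving path), run with step `h` along the drifted path `t ↦ w t + t θ`.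
For instance `Ψ h y w = y + h b(y) + ∑ⱼ wⱼ σⱼ(y)` is the Euler scheme, which along the
drifted path is the Euler scheme of `dX = (b(X) + σ(X) θ) dt + σ(X) dW`, and in dimension one
`Ψ h y w = y + h b(y) + w σ(y) + σ'(y) σ(y) (w² - h) / 2` is the Milstein scheme. -/
def schemePath (Ψ : ℝ → E d → E q → E d) (h : ℝ≥0) (x : E d) (w : ℝ≥0 → E q) (θ : E q) :
    ℕ → E d
  | 0 => x
  | i + 1 => Ψ h (schemePath Ψ h x w θ i) (w ((i + 1) * h) - w (i * h) + (h : ℝ) • θ)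

/-- The value at time `T` of the scheme with `n` steps of size `T / n`. -/
def schemeEnd (Ψ : ℝ → E d → E q → E d) (T : ℝ≥0) (x : E d) (n : ℕ) (w : ℝ≥0 → E q)
    (θ : E q) : E d :=
  schemePath Ψ (T / n) x w θ n

/-- The Girsanov density `exp (-⟨θ, w⟩ - |θ|² T / 2)`. -/
def girsanov (T : ℝ≥0) (w θ : E q) : ℝ :=
  Real.exp (-inner ℝ θ w - ‖θ‖ ^ 2 * T / 2)

end Scheme

/-! ### Multilevel Richardson–Romberg weights

Levels are numbered from `0`: level `l` here is the level `l + 1` of a numbering from `1`, and has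
refinement `M ^ l`. -/

/-- The Vandermonde matrix with entries `n_j ^ (-α i)`, `n_j = M ^ j`. -/
def vandermondeMatrix (α : ℝ) (M L : ℕ) : Matrix (Fin L) (Fin L) ℝ :=
  Matrix.of fun i j => ((M : ℝ) ^ (j : ℕ)) ^ (-(α * (i : ℕ)))

/-- The solution `w` of the system `V w = e₁`. -/
def weight (α : ℝ) (M L : ℕ) : Fin L → ℝ :=
  Matrix.mulVec (vandermondeMatrix α M L)⁻¹ (fun i => if (i : ℕ) = 0 then 1 else 0)

/-- The cumulated weight `∑_{j ≥ l} w_j`. -/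
def cumWeight (α : ℝ) (M L l : ℕ) : ℝ :=
  ∑ j : Fin L, if l ≤ (j : ℕ) then weight α M L j else 0

/-! ### Parameters of the estimator -/

/-- The structural constants: horizon `T`, refinement factor `M`, number `m` of time steps on the
coarsest level, weak and strong error rates `α`, `β`, and the constants `V₁`, `varP`
(the variance of the payoff), `c` and `A` that enter the choice of the sample sizes and of the
number of levels. -/
structure Params where
  T : ℝ≥0
  M : ℕ
  m : ℕ
  α : ℝ
  β : ℝ
  V₁ : ℝ
  varP : ℝ
  c : ℝ
  A : ℝ

namespace Params

variable (r : Params)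

/-- The coarsest time step. -/
def hbar : ℝ := r.T / r.m

def lam : ℝ := Real.sqrt (r.V₁ / r.varP)

def lowC : ℝ := (1 + (r.M : ℝ) ^ (r.β / 2)) / Real.sqrt (1 + (r.M : ℝ)⁻¹)

def upC : ℝ := (1 + (r.M : ℝ) ^ (r.β / 2)) * Real.sqrt (1 + (r.M : ℝ)⁻¹)

/-- The number of levels `L(ε)`. -/
def numLevels (ε : ℝ) : ℕ :=
  ⌈1 / 2 + Real.log (r.c ^ (1 / r.α) * r.hbar) / Real.log r.M
    + Real.sqrt ((1 / 2 + Real.log (r.c ^ (1 / r.α) * r.hbar) / Real.log r.M) ^ 2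
      + 2 * Real.log (r.A / ε) / (r.α * Real.log r.M))⌉₊

/-- The allocation `μ_l / q*` before normalization. -/
def alloc (L l : ℕ) : ℝ :=
  if l = 0 then 1 + r.lam * r.hbar ^ (r.β / 2)
  else r.lam * r.hbar ^ (r.β / 2) * r.lowC * |cumWeight r.α r.M L l|
    * (r.M : ℝ) ^ (-((1 + r.β) / 2) * l)

/-- The normalizing constant `q*`, which makes the `μ_l` sum to one. -/
def qstar (L : ℕ) : ℝ := (∑ l ∈ Finset.range L, r.alloc L l)⁻¹

def mu (L l : ℕ) : ℝ := r.qstar L * r.alloc L l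

/-- The total sample size `N(ε)`. -/
def totalN (ε : ℝ) : ℝ :=
  (1 + 1 / (2 * r.α * r.numLevels ε)) *
    (r.varP * (1 + r.lam * r.hbar ^ (r.β / 2)
      + r.lam * r.hbar ^ (r.β / 2) * r.upC *
        ∑ l ∈ Finset.Ico 1 (r.numLevels ε),
          |cumWeight r.α r.M (r.numLevels ε) l| * (r.M : ℝ) ^ ((1 - r.β) / 2 * l)))
    / (ε ^ 2 * r.qstar (r.numLevels ε))

/-- The sample size `N_l(ε) = ⌈N(ε) μ_l(ε)⌉` of level `l`. -/
def levelN (ε : ℝ) (l : ℕ) : ℕ := ⌈r.totalN ε * r.mu (r.numLevels ε) l⌉₊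

/-- The number of time steps on level `l`. -/
def steps (l : ℕ) : ℕ := r.m * r.M ^ l

end Params

/-! ### The estimator -/

section Estimator

variable {Ω : Type*} {d q : ℕ}

/-- The weighted payoff on level `l` along the driving path `w` with parameter `θ`: the payoff of
the scheme on level `0`, and the difference of the payoffs of the schemes on the levels `l` and
`l - 1` (both driven by `w`) for `l ≥ 1`, times the Girsanov density. -/
def levelTerm (r : Params) (Ψ : ℝ → E d → E q → E d) (x : E d) (P : E d → ℝ)
    (l : ℕ) (w : ℝ≥0 → E q) (θ : E q) : ℝ :=
  (if l = 0 then P (schemeEnd Ψ r.T x (r.steps 0) w θ)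
    else P (schemeEnd Ψ r.T x (r.steps l) w θ) - P (schemeEnd Ψ r.T x (r.steps (l - 1)) w θ))
    * girsanov r.T (w r.T) θ

/-- The adaptive importance sampling ML2R estimator with accuracy parameter `ε`.  The path number
`k` (numbered from `0`) on level `l` is `W l k` and is simulated with the parameter `θ l k`. -/
def estimator (r : Params) (Ψ : ℝ → E d → E q → E d) (x : E d) (P : E d → ℝ)
    (W : ℕ → ℕ → ℝ≥0 → Ω → E q) (θ : ℕ → ℕ → Ω → E q) (ε : ℝ) (ω : Ω) : ℝ :=
  (1 / (r.levelN ε 0 : ℝ)) *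
      ∑ k ∈ Finset.range (r.levelN ε 0),
        levelTerm r Ψ x P 0 (fun t => W 0 k t ω) (θ 0 k ω)
    + ∑ l ∈ Finset.Ico 1 (r.numLevels ε),
      cumWeight r.α r.M (r.numLevels ε) l / (r.levelN ε l : ℝ) *
        ∑ k ∈ Finset.range (r.levelN ε l),
          levelTerm r Ψ x P l (fun t => W l k t ω) (θ l k ω)

end Estimator

/-! ### Error assumptions -/

section Errors

variable {Ω : Type*} [MeasurableSpace Ω] {d q : ℕ}

/-- The payoff of the scheme with `n` steps per coarsest time step, i.e. with step size
`hbar / n`, driven by the reference Brownian motion `B` (without drift parameter). -/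
def approxPayoff (r : Params) (Ψ : ℝ → E d → E q → E d) (x : E d) (P : E d → ℝ)
    (B : ℝ≥0 → Ω → E q) (n : ℕ) (ω : Ω) : ℝ :=
  P (schemeEnd Ψ r.T x (r.m * n) (fun t => B t ω) 0)

/-- Weak error expansion of every order, with rate `α`, for the step sizes
`h = hbar / n`, `n ≥ 1`. -/
def WeakError (r : Params) (Ψ : ℝ → E d → E q → E d) (x : E d) (P : E d → ℝ)
    (B : ℝ≥0 → Ω → E q) (X : ℝ≥0 → Ω → E d) (μ : Measure Ω) : Prop :=
  ∃ c : ℕ → ℝ, ∀ R : ℕ, 1 ≤ R → ∃ η : ℝ → ℝ, Tendsto η (𝓝[>] 0) (𝓝 0) ∧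
    ∀ n : ℕ, 1 ≤ n →
      ∫ ω, approxPayoff r Ψ x P B n ω ∂μ - ∫ ω, P (X r.T ω) ∂μ =
        ∑ k ∈ Finset.Icc 1 R, c k * (r.hbar / n) ^ (r.α * k)
          + (r.hbar / n) ^ (r.α * R) * η (r.hbar / n)

/-- `L^p` strong error of rate `β` with constant `V`, for the step sizes
`h = hbar / n`, `n ≥ 1`. -/
def StrongError (r : Params) (Ψ : ℝ → E d → E q → E d) (x : E d) (P : E d → ℝ)
    (B : ℝ≥0 → Ω → E q) (X : ℝ≥0 → Ω → E d) (μ : Measure Ω) (p V : ℝ) : Prop :=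
  ∀ n : ℕ, 1 ≤ n →
    ∫⁻ ω, ‖approxPayoff r Ψ x P B n ω - P (X r.T ω)‖ₑ ^ p ∂μ
      ≤ ENNReal.ofReal (V * (r.hbar / n) ^ (r.β * p / 2))

end Errors

end AISML2R

end

/-! The estimator splits into a bias and a fluctuation, and each tends to zero as `ε → 0+`; a
summable power of the accuracies forces them to tend to zero.

Bias. After Abel summation (`sum_cumWeight_mul_diff`) the mean of the estimator is `∑ w_j a_j`, with
`a_j` the mean payoff of the scheme on level `j`. The weights are Lagrange basis polynomials at `0`
for the nodes `M^(-αj)`. They sum to one and decay geometrically away from the finest level, so `∑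
w_j a_j` has the same limit as `a_j` (`tendsto_sum_weight_mul`), and the first-order weak expansion
identifies that limit.

Fluctuation. The parameter of each path depends on the past only and the path is independent of the
past. By Girsanov the conditional mean of a level term does not depend on the parameter, so the
centered sums on each level are martingales (`isMartingaleIncrement_levelTerm`). Writing `G` for the
payoff and `J` for the density, `|GJ|^(3/2) ≤ (G² + J²)J`, and the last factor `J` undoes the drift.
Uniform second moments of the payoffs and boundedness of `Θ` therefore give moments of order `3/2`
uniformly over levels and paths. A Hájek–Rényi inequality and a union bound over the levels
(`ae_exists_absPow_sum_le`) yield almost surely `|S_{l,n}| ≤ R (l+1)² n^(3/4)` for all `l` and all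
`n ≥ 1` at once, with a random `R`.

The allocation rule gives `N_l ≥ c |W_l| e^(-κl) / ε²` (`Params.exists_le_levelN`). The weight
cancels in the critical place, so level `l` contributes at most a constant times `ε^(1/2)
e^((2+κ/4)l)`. Since `L(ε)` is of order `√log(1/ε)`, any exponential of `L` costs at most `ε^(-1/4)`
(`Params.exists_exp_numLevels_le`), and the whole fluctuation is `O(ε^(1/4))`
(`tendsto_sum_cumWeight_mul`). -/

noncomputable section

namespace AISML2R

/-! ### Bounds for the weights -/

section Weights

/-- The weights are the values at `0` of the Lagrange basis for the nodes `ρ ^ j`. -/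
def nodeWeight (ρ : ℝ) (L : ℕ) (l : Fin L) : ℝ :=
  (Lagrange.basis Finset.univ (fun j : Fin L => ρ ^ (j : ℕ)) l).eval 0

lemma injective_pow_fin {ρ : ℝ} (h0 : 0 < ρ) (h1 : ρ < 1) (L : ℕ) :
    Function.Injective (fun j : Fin L => ρ ^ (j : ℕ)) := fun _ _ hij =>
  Fin.ext (pow_right_injective₀ h0 h1.ne hij)

/-- Interpolation at `L` nodes reproduces `X^i` for `i < L`; this is that identity evaluated at `0`.
-/
lemma sum_pow_mul_nodeWeight {ρ : ℝ} (h0 : 0 < ρ) (h1 : ρ < 1) (L : ℕ) (i : Fin L) :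
    ∑ l : Fin L, (ρ ^ (l : ℕ)) ^ (i : ℕ) * nodeWeight ρ L l = if (i : ℕ) = 0 then 1 else 0 := by
  have hinj := injective_pow_fin h0 h1 L
  have h := Lagrange.eq_interpolate (s := (Finset.univ : Finset (Fin L)))
    (v := fun j : Fin L => ρ ^ (j : ℕ)) (f := (Polynomial.X : Polynomial ℝ) ^ (i : ℕ))
    hinj.injOn (by
      rw [Polynomial.degree_X_pow]; simp)
  have h2 := congrArg (Polynomial.eval 0) h
  rw [Lagrange.interpolate_apply, Polynomial.eval_finsetSum] at h2
  simp only [Polynomial.eval_mul, Polynomial.eval_C, Polynomial.eval_pow, Polynomial.eval_X] at h2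
  rw [zero_pow_eq] at h2
  exact h2.symm

lemma rpow_neg_alpha_pos {α : ℝ} {M : ℕ} (hM : 2 ≤ M) : 0 < (M : ℝ) ^ (-α) :=
  Real.rpow_pos_of_pos (by positivity) _

lemma rpow_neg_alpha_lt_one {α : ℝ} {M : ℕ} (hα : 0 < α) (hM : 2 ≤ M) : (M : ℝ) ^ (-α) < 1 :=
  Real.rpow_lt_one_of_one_lt_of_neg (by exact_mod_cast (by omega : 1 < M)) (by linarith)

lemma vandermondeMatrix_apply {α : ℝ} {M : ℕ} (L : ℕ) (i j : Fin L) :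
    vandermondeMatrix α M L i j = (((M : ℝ) ^ (-α)) ^ (j : ℕ)) ^ (i : ℕ) := by
  have hM0 : (0 : ℝ) ≤ M := by positivity
  rw [vandermondeMatrix, Matrix.of_apply]
  simp only [← Real.rpow_natCast]
  rw [← Real.rpow_mul hM0, ← Real.rpow_mul hM0, ← Real.rpow_mul hM0]
  congr 1; ring

/-- Both sides solve the same Vandermonde system, which is invertible because the nodes are
distinct. The Lagrange form is a product and can be estimated factor by factor. -/
lemma weight_eq_nodeWeight {α : ℝ} {M : ℕ} (hα : 0 < α) (hM : 2 ≤ M) (L : ℕ) :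
    weight α M L = nodeWeight ((M : ℝ) ^ (-α)) L := by
  have h0 := rpow_neg_alpha_pos (α := α) hM
  have h1 := rpow_neg_alpha_lt_one hα hM
  have hV : vandermondeMatrix α M L =
      Matrix.transpose (Matrix.vandermonde (fun j : Fin L => ((M : ℝ) ^ (-α)) ^ (j : ℕ))) := by
    ext i j
    rw [vandermondeMatrix_apply, Matrix.transpose_apply, Matrix.vandermonde_apply]
  have hdet : IsUnit (vandermondeMatrix α M L).det := by
    rw [hV, Matrix.det_transpose, isUnit_iff_ne_zero]
    exact Matrix.det_vandermonde_ne_zero_iff.2 (injective_pow_fin h0 h1 L)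
  have hsol : Matrix.mulVec (vandermondeMatrix α M L) (nodeWeight ((M : ℝ) ^ (-α)) L) =
      fun i : Fin L => if (i : ℕ) = 0 then (1 : ℝ) else 0 := by
    ext i
    rw [← sum_pow_mul_nodeWeight h0 h1 L i]
    simp only [Matrix.mulVec, dotProduct, vandermondeMatrix_apply]
  rw [weight, ← hsol, Matrix.mulVec_mulVec, Matrix.nonsing_inv_mul _ hdet, Matrix.one_mulVec]

lemma one_div_one_sub_le_exp {u ρ : ℝ} (hu : 0 ≤ u) (huρ : u ≤ ρ) (h1 : ρ < 1) :
    1 / (1 - u) ≤ Real.exp (u / (1 - ρ)) := by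
  have h : 1 / (1 - u) = u / (1 - u) + 1 := by
    have : 1 - u ≠ 0 := by linarith
    field_simp; ring
  rw [h]
  refine (Real.add_one_le_exp _).trans (Real.exp_le_exp.2 ?_)
  exact div_le_div_of_nonneg_left hu (by linarith) (by linarith)

/-- With `k = |l - j|` the factor is `1/(1-ρ^k)` for `j < l` and `ρ^k/(1-ρ^k)` for `j > l`. The
exponential form turns the product of denominators into a convergent sum, and the crude bound `ρ^k ≤
ρ` already gives geometric decay. The truncated differences in the exponent add up to `|l - j|`. -/
lemma abs_node_factor_le {ρ : ℝ} (h0 : 0 < ρ) (h1 : ρ < 1) {l j : ℕ} (hjl : j ≠ l) :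
    |(ρ ^ l - ρ ^ j)⁻¹ * (0 - ρ ^ j)| ≤
      Real.exp (ρ ^ (l - j + (j - l)) / (1 - ρ)) * if l < j then ρ else 1 := by
  rcases lt_or_gt_of_ne hjl with h | h
  · obtain ⟨k, rfl⟩ := Nat.exists_eq_add_of_lt h
    have hk : ρ ^ (k + 1) ≤ ρ := pow_le_of_le_one h0.le h1.le (by omega)
    have hj := pow_pos h0 j
    have e : (ρ ^ (j + k + 1) - ρ ^ j)⁻¹ * (0 - ρ ^ j) = 1 / (1 - ρ ^ (k + 1)) := by
      have h2 : 1 - ρ ^ (k + 1) ≠ 0 := by linarith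
      have h3 : ρ ^ (j + k + 1) - ρ ^ j = -(ρ ^ j * (1 - ρ ^ (k + 1))) := by ring
      rw [h3]; field_simp; ring
    rw [e, abs_of_nonneg (by apply one_div_nonneg.2; linarith), if_neg (by omega), mul_one]
    rw [show j + k + 1 - j + (j - (j + k + 1)) = k + 1 by omega]
    exact one_div_one_sub_le_exp (by positivity) hk h1
  · obtain ⟨k, rfl⟩ := Nat.exists_eq_add_of_lt h
    have hk : ρ ^ (k + 1) ≤ ρ := pow_le_of_le_one h0.le h1.le (by omega)
    have hj := pow_pos h0 l
    have e : (ρ ^ l - ρ ^ (l + k + 1))⁻¹ * (0 - ρ ^ (l + k + 1)) =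
        -(1 / (1 - ρ ^ (k + 1)) * ρ ^ (k + 1)) := by
      have h2 : 1 - ρ ^ (k + 1) ≠ 0 := by linarith
      have h3 : ρ ^ l - ρ ^ (l + k + 1) = ρ ^ l * (1 - ρ ^ (k + 1)) := by ring
      rw [h3]; field_simp; ring
    have h4 : 0 ≤ 1 / (1 - ρ ^ (k + 1)) := by apply one_div_nonneg.2; linarith
    rw [e, abs_neg, abs_of_nonneg (by positivity), if_pos (by omega)]
    rw [show l - (l + k + 1) + (l + k + 1 - l) = k + 1 by omega]
    exact mul_le_mul (one_div_one_sub_le_exp (by positivity) hk h1) hk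
      (by positivity) (by positivity)

lemma geom_sum_le_inv {ρ : ℝ} (h0 : 0 < ρ) (h1 : ρ < 1) (n : ℕ) :
    ∑ i ∈ Finset.range n, ρ ^ i ≤ (1 - ρ)⁻¹ := by
  rw [← tsum_geometric_of_lt_one h0.le h1]
  exact (summable_geometric_of_lt_one h0.le h1).sum_le_tsum _ fun i _ => by positivity

lemma sum_pow_dist_le {ρ : ℝ} (h0 : 0 < ρ) (h1 : ρ < 1) {L l : ℕ} (hl : l < L) :
    ∑ j ∈ Finset.range L, ρ ^ (l - j + (j - l)) ≤ 2 * (1 - ρ)⁻¹ := by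
  obtain ⟨k, rfl⟩ := Nat.exists_eq_add_of_lt hl
  rw [add_assoc, Finset.sum_range_add]
  have e1 : ∑ j ∈ Finset.range l, ρ ^ (l - j + (j - l)) ≤ ∑ j ∈ Finset.range l, ρ ^ j := by
    rw [← Finset.sum_range_reflect (fun j => ρ ^ j)]
    refine Finset.sum_le_sum fun j hj => ?_
    have := Finset.mem_range.1 hj
    exact pow_le_pow_of_le_one h0.le h1.le (by omega)
  have e2 : ∑ j ∈ Finset.range (k + 1), ρ ^ (l - (l + j) + (l + j - l)) =
      ∑ j ∈ Finset.range (k + 1), ρ ^ j :=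
    Finset.sum_congr rfl fun j _ => by congr 1; omega
  rw [e2]
  have := geom_sum_le_inv h0 h1 l
  have := geom_sum_le_inv h0 h1 (k + 1)
  linarith

/-- Each of the `L - 1 - l` nodes with `j > l` contributes one factor `ρ`; the remaining factors
multiply to the exponential of a two-sided geometric sum, bounded independently of `l` and `L`. -/
lemma abs_nodeWeight_le {ρ : ℝ} (h0 : 0 < ρ) (h1 : ρ < 1) (L : ℕ) (l : Fin L) :
    |nodeWeight ρ L l| ≤
      Real.exp (2 * (1 - ρ)⁻¹ / (1 - ρ)) * ρ ^ (L - 1 - (l : ℕ)) := by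
  have hρ1 : 0 < 1 - ρ := by linarith
  have hprod : nodeWeight ρ L l = ∏ j ∈ Finset.univ.erase l,
      ((ρ ^ (l : ℕ) - ρ ^ (j : ℕ))⁻¹ * (0 - ρ ^ (j : ℕ))) := by
    simp [nodeWeight, Lagrange.basis, Lagrange.basisDivisor, Polynomial.eval_prod]
  rw [hprod, Finset.abs_prod]
  calc ∏ j ∈ Finset.univ.erase l, |(ρ ^ (l : ℕ) - ρ ^ (j : ℕ))⁻¹ * (0 - ρ ^ (j : ℕ))|
      ≤ ∏ j ∈ Finset.univ.erase l, (Real.exp (ρ ^ ((l : ℕ) - j + (j - l)) / (1 - ρ)) *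
          if (l : ℕ) < j then ρ else 1) := by
        refine Finset.prod_le_prod (fun _ _ => abs_nonneg _) fun j hj => ?_
        exact abs_node_factor_le h0 h1 fun h => (Finset.mem_erase.1 hj).1 (Fin.ext h)
    _ = Real.exp (∑ j ∈ Finset.univ.erase l, ρ ^ ((l : ℕ) - j + (j - l)) / (1 - ρ)) *
          ∏ j ∈ Finset.univ.erase l, (if (l : ℕ) < (j : Fin L) then ρ else 1) := by
        rw [Finset.prod_mul_distrib, Real.exp_sum]
    _ ≤ _ := by
        refine mul_le_mul (Real.exp_le_exp.2 ?_) (le_of_eq ?_)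
          (Finset.prod_nonneg fun j _ => by split_ifs <;> positivity) (by positivity)
        · rw [← Finset.sum_div]
          gcongr
          refine le_trans (Finset.sum_le_univ_sum_of_nonneg fun j => by positivity) ?_
          rw [Fin.sum_univ_eq_sum_range (fun j => ρ ^ ((l : ℕ) - j + (j - l)))]
          exact sum_pow_dist_le h0 h1 l.2
        · rw [Finset.prod_ite, Finset.prod_const_one, mul_one, Finset.prod_const]
          congr 1
          have : (Finset.univ.erase l).filter (fun j : Fin L => (l : ℕ) < j) = Finset.Ioi l := by
            ext j
            simp only [Finset.mem_filter, Finset.mem_erase, Finset.mem_univ, and_true,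
              Finset.mem_Ioi, Fin.lt_def]
            refine ⟨fun h => h.2, fun h => ⟨fun e => ?_, h⟩⟩
            simp [e] at h
          rw [this, Fin.card_Ioi]

/-- Uniform bound for the weights: they decay geometrically away from the finest level. -/
lemma exists_abs_weight_le {α : ℝ} {M : ℕ} (hα : 0 < α) (hM : 2 ≤ M) :
    ∃ C ρ : ℝ, 0 < C ∧ 0 < ρ ∧ ρ < 1 ∧ ∀ (L : ℕ) (l : Fin L),
      |weight α M L l| ≤ C * ρ ^ (L - 1 - (l : ℕ)) := by
  refine ⟨Real.exp (2 * (1 - (M : ℝ) ^ (-α))⁻¹ / (1 - (M : ℝ) ^ (-α))), (M : ℝ) ^ (-α),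
    Real.exp_pos _, rpow_neg_alpha_pos hM, rpow_neg_alpha_lt_one hα hM,
    fun L l => ?_⟩
  rw [weight_eq_nodeWeight hα hM]
  exact abs_nodeWeight_le (rpow_neg_alpha_pos hM) (rpow_neg_alpha_lt_one hα hM) L l

lemma sum_weight {α : ℝ} {M : ℕ} (hα : 0 < α) (hM : 2 ≤ M) {L : ℕ} (hL : 0 < L) :
    ∑ l : Fin L, weight α M L l = 1 := by
  have := sum_pow_mul_nodeWeight (rpow_neg_alpha_pos (α := α) hM) (rpow_neg_alpha_lt_one hα hM) L
    ⟨0, hL⟩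
  rw [weight_eq_nodeWeight hα hM]
  simpa using this

lemma cumWeight_zero {α : ℝ} {M : ℕ} (hα : 0 < α) (hM : 2 ≤ M) {L : ℕ} (hL : 0 < L) :
    cumWeight α M L 0 = 1 := by
  simpa [cumWeight] using sum_weight hα hM hL

lemma sum_fin_geom_le {ρ : ℝ} (h0 : 0 < ρ) (h1 : ρ < 1) (L : ℕ) :
    ∑ j : Fin L, ρ ^ (L - 1 - (j : ℕ)) ≤ (1 - ρ)⁻¹ := by
  rw [Fin.sum_univ_eq_sum_range (fun j => ρ ^ (L - 1 - j)),
    Finset.sum_range_reflect (fun j => ρ ^ j)]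
  exact geom_sum_le_inv h0 h1 L

lemma exists_abs_cumWeight_le {α : ℝ} {M : ℕ} (hα : 0 < α) (hM : 2 ≤ M) :
    ∃ C : ℝ, 1 ≤ C ∧ ∀ L l : ℕ, |cumWeight α M L l| ≤ C := by
  obtain ⟨C, ρ, hC, h0, h1, hw⟩ := exists_abs_weight_le hα hM
  -- The bound is kept at least `1` so that later `C^(3/4) ≤ C`.
  refine ⟨max 1 (C * (1 - ρ)⁻¹), le_max_left _ _, fun L l => le_trans ?_ (le_max_right _ _)⟩
  calc |cumWeight α M L l| ≤ ∑ j : Fin L, |if l ≤ (j : ℕ) then weight α M L j else 0| :=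
        Finset.abs_sum_le_sum_abs _ _
    _ ≤ ∑ j : Fin L, C * ρ ^ (L - 1 - (j : ℕ)) := by
        refine Finset.sum_le_sum fun j _ => ?_
        split_ifs
        · exact hw L j
        · simp only [abs_zero]; positivity
    _ ≤ C * (1 - ρ)⁻¹ := by
        rw [← Finset.mul_sum]
        exact mul_le_mul_of_nonneg_left (sum_fin_geom_le h0 h1 L) hC.le

/-- Summation by parts: the cumulated weights recombine the level differences. -/
lemma sum_cumWeight_mul_diff {α : ℝ} {M : ℕ} (L : ℕ) (a : ℕ → ℝ) :
    ∑ l ∈ Finset.range L, cumWeight α M L l * (if l = 0 then a 0 else a l - a (l - 1)) =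
      ∑ j : Fin L, weight α M L j * a j := by
  simp only [cumWeight, Finset.sum_mul]
  rw [Finset.sum_comm]
  refine Finset.sum_congr rfl fun j _ => ?_
  have tel : ∀ n : ℕ, ∑ l ∈ Finset.range (n + 1),
      (if l = 0 then a 0 else a l - a (l - 1)) = a n := by
    intro n
    induction n with
    | zero => simp
    | succ n ih => rw [Finset.sum_range_succ, ih]; simp
  rw [← tel j, Finset.mul_sum]
  simp only [ite_mul, zero_mul]
  rw [← Finset.sum_filter]
  refine Finset.sum_congr ?_ fun _ _ => rfl
  ext l
  simp only [Finset.mem_filter, Finset.mem_range]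
  have := j.2
  omega

/-- For fixed distance `i` from the finest level the term tends to zero, and the geometric series
times a bound for `u` dominates. Extending the sum by zero beyond `L` puts it in the form of
dominated convergence for series. -/
lemma tendsto_sum_geom_mul {ρ : ℝ} (h0 : 0 < ρ) (h1 : ρ < 1) {u : ℕ → ℝ}
    (hu : Tendsto u atTop (𝓝 0)) :
    Tendsto (fun L : ℕ => ∑ i ∈ Finset.range L, ρ ^ i * u (L - 1 - i)) atTop (𝓝 0) := by
  obtain ⟨K, hK⟩ : ∃ K, ∀ n, |u n| ≤ K := by
    obtain ⟨K, hK⟩ := (Metric.isBounded_range_of_tendsto u hu).exists_norm_le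
    exact ⟨K, fun n => hK _ ⟨n, rfl⟩⟩
  have hK0 : 0 ≤ K := (abs_nonneg _).trans (hK 0)
  have key := tendsto_tsum_of_dominated_convergence (𝓕 := atTop)
    (f := fun (L : ℕ) (i : ℕ) => if i < L then ρ ^ i * u (L - 1 - i) else 0)
    (g := fun _ => (0 : ℝ)) (bound := fun i => ρ ^ i * K)
    ((summable_geometric_of_lt_one h0.le h1).mul_right K) (fun i => ?_) (.of_forall fun L i => ?_)
  · simp only [tsum_zero] at key
    refine key.congr fun L => ?_
    rw [tsum_eq_sum (s := Finset.range L)]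
    · exact Finset.sum_congr rfl fun i hi => by rw [if_pos (Finset.mem_range.1 hi)]
    · intro i hi; rw [if_neg (by simpa using hi)]
  · have h2 : Tendsto (fun L : ℕ => ρ ^ i * u (L - 1 - i)) atTop (𝓝 0) := by
      have : Tendsto (fun L : ℕ => L - 1 - i) atTop atTop :=
        (tendsto_sub_atTop_nat i).comp (tendsto_sub_atTop_nat 1)
      simpa using (hu.comp this).const_mul (ρ ^ i)
    refine h2.congr' ?_
    filter_upwards [eventually_gt_atTop i] with L hL
    rw [if_pos hL]
  · split_ifs
    · rw [Real.norm_eq_abs, abs_mul, abs_of_nonneg (by positivity : 0 ≤ ρ ^ i)]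
      exact mul_le_mul_of_nonneg_left (hK _) (by positivity)
    · simp only [norm_zero]; positivity

/-- Extrapolation with the weights preserves limits. -/
lemma tendsto_sum_weight_mul {α : ℝ} {M : ℕ} (hα : 0 < α) (hM : 2 ≤ M) {a : ℕ → ℝ} {J : ℝ}
    (ha : Tendsto a atTop (𝓝 J)) :
    Tendsto (fun L : ℕ => ∑ j : Fin L, weight α M L j * a j) atTop (𝓝 J) := by
  obtain ⟨C, ρ, hC, h0, h1, hw⟩ := exists_abs_weight_le hα hM
  rw [tendsto_iff_norm_sub_tendsto_zero]
  have hu : Tendsto (fun n => |a n - J|) atTop (𝓝 0) := by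
    simpa using (tendsto_iff_norm_sub_tendsto_zero.1 ha)
  have hlim := (tendsto_sum_geom_mul h0 h1 hu).const_mul C
  rw [mul_zero] at hlim
  refine squeeze_zero' (.of_forall fun _ => norm_nonneg _) ?_ hlim
  filter_upwards [eventually_gt_atTop 0] with L hL
  have e : ∑ j : Fin L, weight α M L j * a j - J = ∑ j : Fin L, weight α M L j * (a j - J) := by
    simp only [mul_sub, Finset.sum_sub_distrib]
    rw [← Finset.sum_mul, sum_weight hα hM hL, one_mul]
  -- Reflection makes the exponent of `ρ` the distance to the finest level, as in the bound for the
  -- weights.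
  rw [e, Real.norm_eq_abs, ← Finset.sum_range_reflect, Finset.mul_sum]
  refine (Finset.abs_sum_le_sum_abs _ _).trans ?_
  rw [← Fin.sum_univ_eq_sum_range
    (fun j => C * (ρ ^ (L - 1 - j) * |a (L - 1 - (L - 1 - j)) - J|)) L]
  refine Finset.sum_le_sum fun j _ => ?_
  have hj := j.2
  rw [abs_mul, show L - 1 - (L - 1 - (j : ℕ)) = j by omega, ← mul_assoc]
  exact mul_le_mul_of_nonneg_right (hw L j) (abs_nonneg _)

end Weights

/-! ### Growth of the number of levels and of the sample sizes -/

namespace Params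

lemma hbar_pos {r : Params} (hT : 0 < r.T) (hm : 1 ≤ r.m) : 0 < r.hbar :=
  div_pos (by exact_mod_cast hT) (by exact_mod_cast hm)

/-- Completing a square. It trades the square root of a logarithm for an arbitrarily small multiple
of the logarithm. -/
lemma sqrt_le_mul_add {δ : ℝ} (hδ : 0 < δ) (y : ℝ) : √y ≤ δ * |y| + 1 / (4 * δ) := by
  have h1 : √y ≤ √|y| := Real.sqrt_le_sqrt (le_abs_self y)
  have h2 : √|y| * √|y| = |y| := Real.mul_self_sqrt (abs_nonneg y)
  have h3 : δ * |y| + 1 / (4 * δ) - √|y| = δ * (√|y| - 1 / (2 * δ)) ^ 2 := by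
    have h4 : δ * (√|y| - 1 / (2 * δ)) ^ 2 = δ * (√|y| * √|y|) + 1 / (4 * δ) - √|y| := by
      field_simp; ring
    rw [h4, h2]
  have h4 : 0 ≤ δ * (√|y| - 1 / (2 * δ)) ^ 2 := by positivity
  linarith

/-- The number of levels grows so slowly that any exponential of it is dominated by a small
negative power of `ε`. -/
lemma exists_exp_numLevels_le {r : Params} (hM : 2 ≤ r.M) (hα : 0 < r.α) (hA : 0 < r.A)
    {κ : ℝ} (hκ : 0 < κ) :
    ∃ K : ℝ, 0 < K ∧ ∀ ε : ℝ, 0 < ε → ε ≤ 1 →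
      Real.exp (κ * r.numLevels ε) ≤ K * ε ^ (-(1 / 4) : ℝ) := by
  have hlogM : 0 < Real.log r.M := Real.log_pos (by exact_mod_cast (by omega : 1 < r.M))
  set a : ℝ := 1 / 2 + Real.log (r.c ^ (1 / r.α) * r.hbar) / Real.log r.M with ha
  set d : ℝ := 2 / (r.α * Real.log r.M) with hd
  have hd0 : 0 < d := by positivity
  -- Chosen so that `κ δ d = 1/4`, the exponent of `ε` in the claim; `K₀` collects everything free
  -- of `ε`.
  set δ : ℝ := 1 / (4 * κ * d) with hδ
  have hδ0 : 0 < δ := by positivity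
  set K₀ : ℝ := κ * (|a| + 1 + δ * (a ^ 2 + d * |Real.log r.A|) + 1 / (4 * δ)) with hK₀
  refine ⟨Real.exp K₀, Real.exp_pos _, fun ε hε hε1 => ?_⟩
  have hlogε : Real.log ε ≤ 0 := Real.log_nonpos hε.le hε1
  have hnum : (r.numLevels ε : ℝ) ≤ |a| + √(a ^ 2 + d * Real.log (r.A / ε)) + 1 := by
    have h1 : r.numLevels ε ≤ ⌈|a| + √(a ^ 2 + d * Real.log (r.A / ε))⌉₊ := by
      refine Nat.ceil_mono ?_
      rw [← ha, show 2 * Real.log (r.A / ε) / (r.α * Real.log r.M) = d * Real.log (r.A / ε) by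
        rw [hd]; ring]
      gcongr
      exact le_abs_self a
    have h2 := Nat.ceil_lt_add_one
      (show 0 ≤ |a| + √(a ^ 2 + d * Real.log (r.A / ε)) by positivity)
    exact (Nat.cast_le.2 h1).trans h2.le
  have hsq := sqrt_le_mul_add hδ0 (a ^ 2 + d * Real.log (r.A / ε))
  have habs : |a ^ 2 + d * Real.log (r.A / ε)| ≤ a ^ 2 + d * |Real.log r.A| - d * Real.log ε := by
    rw [Real.log_div hA.ne' hε.ne', mul_sub]
    have := abs_nonneg (Real.log r.A)
    have h3 := le_abs_self (Real.log r.A)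
    have h4 := neg_abs_le (Real.log r.A)
    rw [abs_le]
    constructor <;> nlinarith [sq_nonneg a]
  have hδd : κ * δ * d = 1 / 4 := by rw [hδ]; field_simp
  rw [Real.rpow_def_of_pos hε, ← Real.exp_add]
  refine Real.exp_le_exp.2 ?_
  have h5 : (r.numLevels ε : ℝ) ≤
      |a| + (δ * (a ^ 2 + d * |Real.log r.A| - d * Real.log ε) + 1 / (4 * δ)) + 1 := by
    have := mul_le_mul_of_nonneg_left habs hδ0.le
    linarith
  calc κ * (r.numLevels ε : ℝ)
      ≤ κ * (|a| + (δ * (a ^ 2 + d * |Real.log r.A| - d * Real.log ε) + 1 / (4 * δ)) + 1) := by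
        gcongr
    _ = K₀ - κ * δ * d * Real.log ε := by rw [hK₀]; ring
    _ = K₀ + Real.log ε * (-(1 / 4)) := by rw [hδd]; ring

lemma tendsto_numLevels {r : Params} (hM : 2 ≤ r.M) (hα : 0 < r.α) (hA : 0 < r.A) :
    Tendsto r.numLevels (𝓝[>] 0) atTop := by
  have hlogM : 0 < Real.log r.M := Real.log_pos (by exact_mod_cast (by omega : 1 < r.M))
  refine tendsto_nat_ceil_atTop.comp (tendsto_atTop_add_const_left _ _
    (Real.tendsto_sqrt_atTop.comp (tendsto_atTop_add_const_left _ _ ?_)))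
  refine Tendsto.atTop_div_const (by positivity) (Tendsto.const_mul_atTop two_pos ?_)
  refine Real.tendsto_log_atTop.comp ?_
  exact tendsto_inv_nhdsGT_zero.const_mul_atTop hA

lemma alloc_nonneg {r : Params} (hT : 0 < r.T) (hm : 1 ≤ r.m) (L l : ℕ) : 0 ≤ r.alloc L l := by
  have := hbar_pos hT hm
  have : 0 ≤ r.lam := Real.sqrt_nonneg _
  have : 0 ≤ r.lowC := by unfold lowC; positivity
  unfold alloc
  split_ifs <;> positivity

lemma one_le_alloc_zero {r : Params} (hT : 0 < r.T) (hm : 1 ≤ r.m) (L : ℕ) :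
    1 ≤ r.alloc L 0 := by
  have := hbar_pos hT hm
  have : 0 ≤ r.lam := Real.sqrt_nonneg _
  have : 0 ≤ r.lam * r.hbar ^ (r.β / 2) := by positivity
  simp only [alloc, if_true]
  linarith

/-- The normalization `q*` cancels between `N(ε)` and `μ_l`, and the remaining prefactors are at
least one. -/
lemma le_levelN {r : Params} (hT : 0 < r.T) (hm : 1 ≤ r.m) (hα : 0 < r.α)
    (hvar : 0 < r.varP) {ε : ℝ} (hε : 0 < ε) (hL : 0 < r.numLevels ε) (l : ℕ) :
    r.varP * r.alloc (r.numLevels ε) l / ε ^ 2 ≤ r.levelN ε l := by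
  refine le_trans ?_ (Nat.le_ceil _)
  have hq : 0 < r.qstar (r.numLevels ε) := by
    refine inv_pos.2 (lt_of_lt_of_le one_pos ((one_le_alloc_zero hT hm (r.numLevels ε)).trans ?_))
    exact Finset.single_le_sum (f := fun l => r.alloc (r.numLevels ε) l)
      (fun l _ => alloc_nonneg hT hm _ l) (Finset.mem_range.2 hL)
  have hh := hbar_pos hT hm
  have hlam : 0 ≤ r.lam := Real.sqrt_nonneg _
  have hup : 0 ≤ r.upC := by unfold upC; positivity
  have hal := alloc_nonneg hT hm (r.numLevels ε) l
  set s : ℝ := r.lam * r.hbar ^ (r.β / 2)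
      + r.lam * r.hbar ^ (r.β / 2) * r.upC * ∑ l ∈ Finset.Ico 1 (r.numLevels ε),
          |cumWeight r.α r.M (r.numLevels ε) l| * (r.M : ℝ) ^ ((1 - r.β) / 2 * l) with hs
  have hs0 : 0 ≤ s := by positivity
  have htot : r.totalN ε * r.mu (r.numLevels ε) l =
      (1 + 1 / (2 * r.α * r.numLevels ε)) * (1 + s) *
        (r.varP * r.alloc (r.numLevels ε) l / ε ^ 2) := by
    rw [totalN, mu, add_assoc (1 : ℝ), ← hs]
    field_simp
  rw [htot]
  have h1 : 1 ≤ (1 + 1 / (2 * r.α * r.numLevels ε)) * (1 + s) := by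
    have : 0 ≤ 1 / (2 * r.α * r.numLevels ε) := by positivity
    nlinarith
  exact le_mul_of_one_le_left (by positivity) h1

/-- Lower bound for the sample sizes, uniform in the level. -/
lemma exists_le_levelN {r : Params} (hT : 0 < r.T) (hM : 2 ≤ r.M) (hm : 1 ≤ r.m) (hα : 0 < r.α)
    (hβ : 0 < r.β) (hV₁ : 0 < r.V₁) (hvar : 0 < r.varP) :
    ∃ c κ : ℝ, 0 < c ∧ 0 < κ ∧ ∀ ε : ℝ, 0 < ε → 0 < r.numLevels ε → ∀ l : ℕ,
      c * |cumWeight r.α r.M (r.numLevels ε) l| * Real.exp (-(κ * l)) / ε ^ 2 ≤ r.levelN ε l := by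
  have hlogM : 0 < Real.log r.M := Real.log_pos (by exact_mod_cast (by omega : 1 < r.M))
  have hM0 : (0 : ℝ) < r.M := by exact_mod_cast (by omega : 0 < r.M)
  have hh := hbar_pos hT hm
  set c₁ : ℝ := r.lam * r.hbar ^ (r.β / 2) * r.lowC with hc₁
  have hlam : 0 < r.lam := Real.sqrt_pos.2 (by positivity)
  have hlow : 0 < r.lowC := by unfold lowC; positivity
  have hc₁0 : 0 < c₁ := by positivity
  -- The power of `M` in the allocation is `exp(-κ l)` for this `κ`. The minimum with `1` covers
  -- level `0`, where the cumulated weight is `1` and the allocation at least `1`.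
  refine ⟨r.varP * min 1 c₁, Real.log r.M * ((1 + r.β) / 2), by positivity, by positivity,
    fun ε hε hL l => (le_levelN hT hm hα hvar hε hL l).trans' ?_⟩
  rw [mul_assoc, mul_assoc]
  gcongr
  rcases Nat.eq_zero_or_pos l with rfl | hl
  · refine le_trans ?_ (one_le_alloc_zero hT hm _)
    simp [cumWeight_zero hα hM hL]
  · rw [alloc, if_neg hl.ne', ← hc₁, Real.rpow_def_of_pos hM0,
      show Real.log r.M * (-((1 + r.β) / 2) * l) = -(Real.log r.M * ((1 + r.β) / 2) * l) by ring,
      ← mul_assoc]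
    gcongr
    exact min_le_right _ _

end Params

/-! ### A maximal inequality for martingales with moments of order `3/2` -/

section Maximal

/-- `|x| ^ (3/2)`. -/
def absPow (x : ℝ) : ℝ := |x| ^ (3 / 2 : ℝ)

/-- `sign x * |x| ^ (1/2)`, up to the factor `3/2` the derivative of `absPow`. -/
def signSqrt (x : ℝ) : ℝ := SignType.sign x * √|x|

lemma absPow_nonneg (x : ℝ) : 0 ≤ absPow x := Real.rpow_nonneg (abs_nonneg x) _

lemma absPow_eq (x : ℝ) : absPow x = √|x| ^ 3 := by
  rw [absPow, Real.sqrt_eq_rpow, ← Real.rpow_natCast, ← Real.rpow_mul (abs_nonneg x)]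
  norm_num

lemma abs_signSqrt_le (x : ℝ) : |signSqrt x| ≤ √|x| := by
  rcases lt_trichotomy x 0 with h | h | h <;>
    simp [signSqrt, h, abs_of_nonneg (Real.sqrt_nonneg |x|)]

lemma signSqrt_mul_self (x : ℝ) : signSqrt x * x = √|x| ^ 3 := by
  have h : √|x| ^ 3 = √|x| * |x| := by
    rw [pow_succ', Real.sq_sqrt (abs_nonneg x)]
  rw [h]
  rcases lt_trichotomy x 0 with h | h | h <;> simp [signSqrt, h, abs_of_neg, abs_of_pos, mul_comm]

/-- `absPow` lies above its tangents. -/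
lemma absPow_tangent (x y : ℝ) : absPow x + 3 / 2 * signSqrt x * (y - x) ≤ absPow y := by
  rw [absPow_eq, absPow_eq]
  have h1 : signSqrt x * y ≤ √|x| * √|y| ^ 2 := by
    rw [Real.sq_sqrt (abs_nonneg y)]
    calc signSqrt x * y ≤ |signSqrt x * y| := le_abs_self _
      _ = |signSqrt x| * |y| := abs_mul _ _
      _ ≤ _ := by gcongr; exact abs_signSqrt_le x
  have h2 := signSqrt_mul_self x
  have h3 : 0 ≤ (√|y| - √|x|) ^ 2 * (2 * √|y| + √|x|) := by positivity
  nlinarith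

lemma signSqrt_of_nonneg {x : ℝ} (hx : 0 ≤ x) : signSqrt x = √x := by
  rcases hx.eq_or_lt with h | h
  · simp [signSqrt, ← h]
  · simp [signSqrt, h, abs_of_pos]

lemma signSqrt_neg (x : ℝ) : signSqrt (-x) = -signSqrt x := by
  rcases lt_trichotomy x 0 with h | h | h <;> simp [signSqrt, h]

lemma abs_sqrt_sub_sqrt_le {x y : ℝ} (hx : 0 ≤ x) (hy : 0 ≤ y) : |√x - √y| ≤ √|x - y| := by
  wlog h : y ≤ x generalizing x y
  · rw [abs_sub_comm, abs_sub_comm x y]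
    exact this hy hx (le_of_not_ge h)
  rw [abs_of_nonneg (sub_nonneg.2 (Real.sqrt_le_sqrt h)), abs_of_nonneg (sub_nonneg.2 h)]
  rw [sub_le_iff_le_add]
  refine Real.sqrt_le_iff.2 ⟨by positivity, ?_⟩
  have h1 := Real.sq_sqrt (sub_nonneg.2 h)
  have h2 := Real.sq_sqrt hy
  nlinarith [mul_nonneg (Real.sqrt_nonneg (x - y)) (Real.sqrt_nonneg y)]

/-- For equal signs the square root is Hölder of order `1/2` with constant one; for opposite signs
both roots are at most `√|x - y|`, hence the `2`. -/
lemma abs_signSqrt_sub_le (x y : ℝ) : |signSqrt x - signSqrt y| ≤ 2 * √|x - y| := by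
  wlog hx : 0 ≤ x generalizing x y
  · have := this (-x) (-y) (by linarith)
    rwa [signSqrt_neg, signSqrt_neg, ← neg_sub', abs_neg, ← neg_sub', abs_neg] at this
  rw [signSqrt_of_nonneg hx]
  rcases le_total 0 y with hy | hy
  · rw [signSqrt_of_nonneg hy]
    have := abs_sqrt_sub_sqrt_le hx hy
    have := Real.sqrt_nonneg |x - y|
    linarith
  · have : signSqrt y = -√(-y) := by
      rw [← signSqrt_of_nonneg (neg_nonneg.2 hy), signSqrt_neg, neg_neg]
    rw [this, sub_neg_eq_add, abs_of_nonneg (by positivity), abs_of_nonneg (by linarith)]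
    have h1 : √x ≤ √(x - y) := Real.sqrt_le_sqrt (by linarith)
    have h2 : √(-y) ≤ √(x - y) := Real.sqrt_le_sqrt (by linarith)
    linarith

/-- Second order control of `absPow`. -/
lemma absPow_add_le (a b : ℝ) :
    absPow (a + b) ≤ absPow a + 3 / 2 * (signSqrt a * b) + 3 * absPow b := by
  -- The tangent is taken at `a + b` and evaluated at `a`; moving its slope back to `a` costs `2
  -- √|b| |b|` by the Hölder bound.
  have h1 := absPow_tangent (a + b) a
  have h2 : (signSqrt (a + b) - signSqrt a) * b ≤ 2 * absPow b := by
    calc (signSqrt (a + b) - signSqrt a) * b ≤ |(signSqrt (a + b) - signSqrt a) * b| :=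
          le_abs_self _
      _ = |signSqrt (a + b) - signSqrt a| * |b| := abs_mul _ _
      _ ≤ 2 * √|b| * |b| := by
          have := abs_signSqrt_sub_le (a + b) a
          rw [add_sub_cancel_left] at this
          gcongr
      _ = 2 * absPow b := by
          rw [absPow_eq, pow_succ' √|b| 2, Real.sq_sqrt (abs_nonneg b)]; ring
  nlinarith

lemma absPow_add_le_four (a b : ℝ) : absPow (a + b) ≤ 4 * (absPow a + absPow b) := by
  have h0 : ∀ x y : ℝ, |x| ≤ |y| → absPow (x + y) ≤ 4 * absPow y := by
    intro x y h
    have h1 : |x + y| ≤ 2 * |y| := by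
      have := abs_add_le x y
      linarith
    have h2 : absPow (x + y) ≤ (2 * |y|) ^ (3 / 2 : ℝ) :=
      Real.rpow_le_rpow (abs_nonneg _) h1 (by norm_num)
    rw [Real.mul_rpow (by norm_num) (abs_nonneg y)] at h2
    have h3 : (2 : ℝ) ^ (3 / 2 : ℝ) ≤ 4 := by
      calc (2 : ℝ) ^ (3 / 2 : ℝ) ≤ 2 ^ (2 : ℝ) :=
            Real.rpow_le_rpow_of_exponent_le (by norm_num) (by norm_num)
        _ = 4 := by norm_num
    exact h2.trans (mul_le_mul_of_nonneg_right h3 (absPow_nonneg y))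
  have ha := absPow_nonneg a
  have hb := absPow_nonneg b
  rcases le_total |a| |b| with h | h
  · have := h0 a b h; linarith
  · have := h0 b a h; rw [add_comm]; linarith

lemma measurable_absPow : Measurable absPow := by unfold absPow; fun_prop

lemma continuous_signSqrt : Continuous signSqrt := by
  rw [Metric.continuous_iff']
  intro a ε hε
  have h : Tendsto (fun x : ℝ => 2 * √|x - a|) (𝓝 a) (𝓝 (2 * √|a - a|)) :=
    Continuous.tendsto (by fun_prop) a
  rw [sub_self, abs_zero, Real.sqrt_zero, mul_zero] at h
  filter_upwards [h.eventually (gt_mem_nhds hε)] with x hx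
  exact (abs_signSqrt_sub_le x a).trans_lt hx

lemma abs_signSqrt_le_one_add (x : ℝ) : |signSqrt x| ≤ 1 + absPow x := by
  refine (abs_signSqrt_le x).trans ?_
  rw [absPow_eq]
  have := Real.sqrt_nonneg |x|
  nlinarith [sq_nonneg (√|x| - 1), sq_nonneg (√|x| + 1), pow_nonneg this 3]

variable {Ω : Type*} [mΩ : MeasurableSpace Ω] {μ : Measure Ω}

/-- `D` is a sequence of martingale increments for the σ-algebras `𝓖`, with moments of order
`3/2` at most `C`. -/
structure IsMartingaleIncrement (𝓖 : ℕ → MeasurableSpace Ω) (D : ℕ → Ω → ℝ) (C : ℝ)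
    (μ : Measure Ω) : Prop where
  mono : Monotone 𝓖
  le : ∀ k, 𝓖 k ≤ mΩ
  measurable : ∀ k, Measurable[𝓖 (k + 1)] (D k)
  integrable_absPow : ∀ k, Integrable (fun ω => absPow (D k ω)) μ
  integral_absPow_le : ∀ k, ∫ ω, absPow (D k ω) ∂μ ≤ C
  integrable_mul : ∀ k (g : Ω → ℝ), Measurable[𝓖 k] g → Integrable g μ →
    Integrable (fun ω => g ω * D k ω) μ
  integral_mul : ∀ k (g : Ω → ℝ), Measurable[𝓖 k] g → Integrable g μ →
    ∫ ω, g ω * D k ω ∂μ = 0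

namespace IsMartingaleIncrement

variable {𝓖 : ℕ → MeasurableSpace Ω} {D : ℕ → Ω → ℝ} {C : ℝ}

lemma measurable_sum (h : IsMartingaleIncrement 𝓖 D C μ) (n : ℕ) :
    Measurable[𝓖 n] (fun ω => ∑ k ∈ Finset.range n, D k ω) :=
  Finset.measurable_sum _ fun k hk =>
    (h.measurable k).mono (h.mono (Finset.mem_range.1 hk)) le_rfl

lemma integrable_absPow_sum (h : IsMartingaleIncrement 𝓖 D C μ) (n : ℕ) :
    Integrable (fun ω => absPow (∑ k ∈ Finset.range n, D k ω)) μ := by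
  induction n with
  | zero => simp [absPow]
  | succ n ih =>
    refine Integrable.mono' ((ih.add (h.integrable_absPow n)).const_mul 4) ?_ (.of_forall ?_)
    · exact (measurable_absPow.comp
        ((h.measurable_sum (n + 1)).mono (h.le _) le_rfl)).aestronglyMeasurable
    · intro ω
      rw [Real.norm_of_nonneg (absPow_nonneg _), Finset.sum_range_succ]
      exact absPow_add_le_four _ _

/-- One step of the maximal inequality. -/
lemma setIntegral_absPow_succ_le [IsProbabilityMeasure μ]
    (h : IsMartingaleIncrement 𝓖 D C μ) (n : ℕ) {A : Set Ω}
    (hA : MeasurableSet[𝓖 n] A) :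
    ∫ ω in A, absPow (∑ k ∈ Finset.range (n + 1), D k ω) ∂μ ≤
      ∫ ω in A, absPow (∑ k ∈ Finset.range n, D k ω) ∂μ + 3 * C := by
  set S : Ω → ℝ := fun ω => ∑ k ∈ Finset.range n, D k ω with hS
  have hAm : MeasurableSet A := h.le n A hA
  -- The test variable that removes the linear term of the expansion. It is integrable but in
  -- general unbounded, which is why the martingale property is required for integrable `g`.
  set g : Ω → ℝ := A.indicator fun ω => signSqrt (S ω) with hg
  have hgm : Measurable[𝓖 n] g :=
    Measurable.indicator (continuous_signSqrt.measurable.comp (h.measurable_sum n)) hA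
  have hgi : Integrable g μ := by
    refine Integrable.mono' ((integrable_const (1 : ℝ)).add (h.integrable_absPow_sum n))
      (hgm.mono (h.le n) le_rfl).aestronglyMeasurable (.of_forall fun ω => ?_)
    refine (norm_indicator_le_norm_self _ _).trans ?_
    exact abs_signSqrt_le_one_add _
  have hI := h.integrable_mul n g hgm hgi
  have h0 := h.integral_mul n g hgm hgi
  have hind : (fun ω => g ω * D n ω) = A.indicator fun ω => signSqrt (S ω) * D n ω := by
    ext ω
    by_cases hω : ω ∈ A <;> simp [hg, hω]
  rw [hind] at hI h0
  rw [integral_indicator hAm] at h0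
  rw [integrable_indicator_iff hAm] at hI
  have i1 : IntegrableOn (fun ω => absPow (S ω)) A μ := (h.integrable_absPow_sum n).integrableOn
  have i2 : IntegrableOn (fun ω => absPow (D n ω)) A μ := (h.integrable_absPow n).integrableOn
  calc ∫ ω in A, absPow (∑ k ∈ Finset.range (n + 1), D k ω) ∂μ
      ≤ ∫ ω in A, ((absPow (S ω) + 3 / 2 * (signSqrt (S ω) * D n ω)) +
          3 * absPow (D n ω)) ∂μ := by
        refine integral_mono (h.integrable_absPow_sum (n + 1)).integrableOn
          ((i1.add (hI.const_mul _)).add (i2.const_mul _)) fun ω => ?_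
        simp only [Finset.sum_range_succ]
        exact absPow_add_le _ _
    _ = ∫ ω in A, absPow (S ω) ∂μ + 3 * ∫ ω in A, absPow (D n ω) ∂μ := by
        have i3 := hI.const_mul (3 / 2)
        have i4 : IntegrableOn
            (fun ω => absPow (S ω) + 3 / 2 * (signSqrt (S ω) * D n ω)) A μ := i1.add i3
        rw [integral_add i4 (i2.const_mul 3), integral_add i1 i3, integral_const_mul,
          integral_const_mul, h0]
        simp
    _ ≤ _ := by
        have : ∫ ω in A, absPow (D n ω) ∂μ ≤ C :=
          (setIntegral_le_integral (h.integrable_absPow n)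
            (.of_forall fun ω => absPow_nonneg _)).trans (h.integral_absPow_le n)
        linarith

lemma nonneg_const (h : IsMartingaleIncrement 𝓖 D C μ) : 0 ≤ C :=
  (integral_nonneg fun ω => absPow_nonneg (D 0 ω)).trans (h.integral_absPow_le 0)

/-- Hájek–Rényi type maximal inequality, finite horizon. -/
lemma measureReal_exists_le_aux [IsProbabilityMeasure μ]
    (h : IsMartingaleIncrement 𝓖 D C μ) {a : ℕ → ℝ} (ha : Monotone a)
    (ha0 : 0 < a 0) {t : ℝ} (ht : 0 < t) (n : ℕ) :
    t * μ.real {ω | ∃ j ≤ n, t * a j ≤ absPow (∑ k ∈ Finset.range j, D k ω)} +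
      (∫ ω in {ω | ∃ j ≤ n, t * a j ≤ absPow (∑ k ∈ Finset.range j, D k ω)}ᶜ,
        absPow (∑ k ∈ Finset.range n, D k ω) ∂μ) / a n ≤
      3 * C * ∑ k ∈ Finset.range n, 1 / a (k + 1) := by
  have hapos : ∀ n, 0 < a n := fun n => ha0.trans_le (ha (Nat.zero_le n))
  have hset : ∀ j, MeasurableSet[𝓖 j] {ω | t * a j ≤ absPow (∑ k ∈ Finset.range j, D k ω)} :=
    fun j => (measurable_absPow.comp (h.measurable_sum j)) measurableSet_Ici
  have hmeas : ∀ n, MeasurableSet[𝓖 n]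
      {ω | ∃ j ≤ n, t * a j ≤ absPow (∑ k ∈ Finset.range j, D k ω)} := by
    intro n
    have : {ω | ∃ j ≤ n, t * a j ≤ absPow (∑ k ∈ Finset.range j, D k ω)} =
        ⋃ j ∈ Set.Iic n, {ω | t * a j ≤ absPow (∑ k ∈ Finset.range j, D k ω)} := by
      ext ω; simp
    rw [this]
    exact MeasurableSet.biUnion (Set.to_countable _) fun j hj => h.mono hj _ (hset j)
  -- The integral over the complement is what makes the induction close. At each step it splits into
  -- the part where the threshold is first crossed, where Markov's inequality yields the new
  -- probability, and the part carried on.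
  induction n with
  | zero =>
    have : {ω | ∃ j ≤ 0, t * a j ≤ absPow (∑ k ∈ Finset.range j, D k ω)} = ∅ := by
      ext ω
      simp only [Nat.le_zero, exists_eq_left, Finset.range_zero, Finset.sum_empty,
        Set.mem_ofPred_eq, Set.mem_empty_iff_false, iff_false, not_le]
      have : absPow 0 = 0 := by simp [absPow]
      rw [this]
      positivity
    rw [this]
    simp [absPow]
  | succ n ih =>
    set E₀ := {ω | ∃ j ≤ n, t * a j ≤ absPow (∑ k ∈ Finset.range j, D k ω)} with hE₀
    set F := {ω | t * a (n + 1) ≤ absPow (∑ k ∈ Finset.range (n + 1), D k ω)} with hF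
    have hE : {ω | ∃ j ≤ n + 1, t * a j ≤ absPow (∑ k ∈ Finset.range j, D k ω)} =
        E₀ ∪ (F \ E₀) := by
      rw [Set.union_sdiff_self]
      ext ω
      simp only [Set.mem_ofPred_eq, Set.mem_union, hE₀, hF]
      constructor
      · rintro ⟨j, hj, h⟩
        rcases Nat.le_succ_iff.1 hj with h' | rfl
        · exact Or.inl ⟨j, h', h⟩
        · exact Or.inr h
      · rintro (⟨j, hj, h⟩ | h)
        · exact ⟨j, by omega, h⟩
        · exact ⟨n + 1, le_rfl, h⟩
    have hE₀m : MeasurableSet E₀ := h.le n _ (hmeas n)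
    have hFm : MeasurableSet F := h.le _ _ (hset (n + 1))
    rw [hE, measureReal_union Set.disjoint_sdiff_right (hFm.diff hE₀m)]
    have hInteg := h.integrable_absPow_sum (n + 1)
    have hsplit : ∫ ω in E₀ᶜ, absPow (∑ k ∈ Finset.range (n + 1), D k ω) ∂μ =
        ∫ ω in F \ E₀, absPow (∑ k ∈ Finset.range (n + 1), D k ω) ∂μ +
        ∫ ω in (E₀ ∪ (F \ E₀))ᶜ, absPow (∑ k ∈ Finset.range (n + 1), D k ω) ∂μ := by
      rw [← setIntegral_union _ (hE₀m.union (hFm.diff hE₀m)).compl hInteg.integrableOn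
        hInteg.integrableOn]
      · congr 2
        ext ω
        simp only [Set.mem_compl_iff, Set.mem_union, Set.mem_sdiff]
        tauto
      · rw [Set.disjoint_left]
        intro ω h1 h2
        exact h2 (Or.inr h1)
    have hlow : t * a (n + 1) * μ.real (F \ E₀) ≤
        ∫ ω in F \ E₀, absPow (∑ k ∈ Finset.range (n + 1), D k ω) ∂μ := by
      have := setIntegral_ge_of_const_le_real (hFm.diff hE₀m) (measure_ne_top μ _)
        (fun ω hω => hω.1) hInteg.integrableOn
      exact this
    have hstep := h.setIntegral_absPow_succ_le n (hmeas n).compl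
    have hpos : 0 ≤ ∫ ω in E₀ᶜ, absPow (∑ k ∈ Finset.range n, D k ω) ∂μ :=
      integral_nonneg fun ω => absPow_nonneg _
    have han := hapos n
    have han1 := hapos (n + 1)
    -- Monotonicity of `a` allows the carried integral to be renormalized.
    have hdiv : (∫ ω in E₀ᶜ, absPow (∑ k ∈ Finset.range n, D k ω) ∂μ) / a (n + 1) ≤
        (∫ ω in E₀ᶜ, absPow (∑ k ∈ Finset.range n, D k ω) ∂μ) / a n :=
      div_le_div_of_nonneg_left hpos han (ha (Nat.le_succ n))
    rw [Finset.sum_range_succ, mul_add]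
    have key : t * μ.real (F \ E₀) +
        (∫ ω in (E₀ ∪ (F \ E₀))ᶜ, absPow (∑ k ∈ Finset.range (n + 1), D k ω) ∂μ) / a (n + 1) ≤
        (∫ ω in E₀ᶜ, absPow (∑ k ∈ Finset.range n, D k ω) ∂μ) / a (n + 1) +
          3 * C * (1 / a (n + 1)) := by
      rw [show t * μ.real (F \ E₀) = t * a (n + 1) * μ.real (F \ E₀) / a (n + 1) by field_simp,
        ← add_div, mul_one_div, ← add_div]
      refine div_le_div_of_nonneg_right ?_ han1.le
      rw [← hE₀] at hstep
      linarith
    linarith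

/-- Hájek–Rényi type maximal inequality. -/
lemma measure_exists_le [IsProbabilityMeasure μ]
    (h : IsMartingaleIncrement 𝓖 D C μ) {a : ℕ → ℝ} (ha : Monotone a)
    (ha0 : 0 < a 0) (has : Summable fun k => 1 / a (k + 1)) {t : ℝ} (ht : 0 < t) :
    μ {ω | ∃ j, t * a j ≤ absPow (∑ k ∈ Finset.range j, D k ω)} ≤
      ENNReal.ofReal (3 * C * (∑' k, 1 / a (k + 1)) / t) := by
  have hapos : ∀ n, 0 < a n := fun n => ha0.trans_le (ha (Nat.zero_le n))
  have hC := h.nonneg_const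
  have hU : {ω | ∃ j, t * a j ≤ absPow (∑ k ∈ Finset.range j, D k ω)} =
      ⋃ n, {ω | ∃ j ≤ n, t * a j ≤ absPow (∑ k ∈ Finset.range j, D k ω)} := by
    ext ω
    simp only [Set.mem_ofPred_eq, Set.mem_iUnion]
    exact ⟨fun ⟨j, hj⟩ => ⟨j, j, le_rfl, hj⟩, fun ⟨_, j, _, hj⟩ => ⟨j, hj⟩⟩
  have hmono : Monotone fun n =>
      {ω | ∃ j ≤ n, t * a j ≤ absPow (∑ k ∈ Finset.range j, D k ω)} :=
    fun m n hmn ω ⟨j, hj, h⟩ => ⟨j, hj.trans hmn, h⟩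
  rw [hU, hmono.measure_iUnion]
  refine iSup_le fun n => ?_
  rw [← ofReal_measureReal]
  refine ENNReal.ofReal_le_ofReal ?_
  rw [le_div_iff₀ ht, mul_comm]
  have h1 := h.measureReal_exists_le_aux ha ha0 ht n
  have h2 : 0 ≤ (∫ ω in {ω | ∃ j ≤ n, t * a j ≤ absPow (∑ k ∈ Finset.range j, D k ω)}ᶜ,
        absPow (∑ k ∈ Finset.range n, D k ω) ∂μ) / a n :=
    div_nonneg (integral_nonneg fun ω => absPow_nonneg _) (hapos n).le
  have h3 : ∑ k ∈ Finset.range n, 1 / a (k + 1) ≤ ∑' k, 1 / a (k + 1) :=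
    has.sum_le_tsum _ fun k _ => by have := hapos (k + 1); positivity
  have h4 := mul_le_mul_of_nonneg_left h3 (by positivity : 0 ≤ 3 * C)
  linarith

end IsMartingaleIncrement

/-- A family of martingales whose increments have uniformly bounded moments of order `3/2` grows,
simultaneously along the family, at most like a power `< 1` of time. -/
lemma ae_exists_absPow_sum_le [IsProbabilityMeasure μ]
    {𝓖 : ℕ → MeasurableSpace Ω} {D : ℕ → ℕ → Ω → ℝ} {C : ℝ}
    (h : ∀ l, IsMartingaleIncrement 𝓖 (D l) C μ) :
    ∀ᵐ ω ∂μ, ∃ R : ℝ, 0 < R ∧ ∀ l n : ℕ,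
      absPow (∑ k ∈ Finset.range n, D l k ω) ≤
        R * ((l : ℝ) + 1) ^ 3 * ((n : ℝ) + 1) ^ (9 / 8 : ℝ) := by
  -- The exponent exceeds `1`, for summability, while `9/8 · 2/3 = 3/4 < 1`. The cube in `l + 1`
  -- makes the union bound over levels summable and becomes a square after the power `2/3`.
  set a : ℕ → ℝ := fun n => ((n : ℝ) + 1) ^ (9 / 8 : ℝ) with hadef
  have ha : Monotone a := fun m n hmn => by
    simp only [hadef]
    gcongr
  have ha0 : 0 < a 0 := by simp [hadef]
  have has : Summable fun k => 1 / a (k + 1) := by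
    have h1 := Real.summable_one_div_nat_rpow.2 (show (1 : ℝ) < 9 / 8 by norm_num)
    refine ((summable_nat_add_iff 2).2 h1).congr fun k => ?_
    simp only [hadef]
    push_cast
    congr 2
    ring
  have hl3 : Summable fun l : ℕ => 1 / ((l : ℝ) + 1) ^ 3 := by
    have h1 := Real.summable_one_div_nat_pow.2 (show 1 < 3 by norm_num)
    refine ((summable_nat_add_iff 1).2 h1).congr fun k => ?_
    push_cast
    rfl
  have hC := (h 0).nonneg_const
  set K : ℝ := 3 * C * (∑' k, 1 / a (k + 1)) with hK
  have hK0 : 0 ≤ K := mul_nonneg (by positivity) (tsum_nonneg fun k => by positivity)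
  set T : ℝ := ∑' l : ℕ, 1 / ((l : ℝ) + 1) ^ 3 with hT
  -- The exceptional event lies in the failure event for every fixed `R`, whose probability is
  -- `O(1/R)`.
  have hbound : ∀ R : ℕ, 0 < R → μ {ω | ¬ ∃ R : ℝ, 0 < R ∧ ∀ l n : ℕ,
      absPow (∑ k ∈ Finset.range n, D l k ω) ≤
        R * ((l : ℝ) + 1) ^ 3 * ((n : ℝ) + 1) ^ (9 / 8 : ℝ)} ≤ ENNReal.ofReal (K * T / R) := by
    intro R hR
    have hR' : (0 : ℝ) < R := by exact_mod_cast hR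
    calc _ ≤ μ (⋃ l : ℕ, {ω | ∃ j, (R * ((l : ℝ) + 1) ^ 3) * a j ≤
            absPow (∑ k ∈ Finset.range j, D l k ω)}) := by
          refine measure_mono fun ω hω => ?_
          by_contra hcon
          simp only [Set.mem_iUnion, Set.mem_ofPred_eq, not_exists, not_le] at hcon
          exact hω ⟨R, hR', fun l n => (hcon l n).le⟩
      _ ≤ ∑' l : ℕ, μ {ω | ∃ j, (R * ((l : ℝ) + 1) ^ 3) * a j ≤
            absPow (∑ k ∈ Finset.range j, D l k ω)} := measure_iUnion_le _
      _ ≤ ∑' l : ℕ, ENNReal.ofReal (K / R * (1 / ((l : ℝ) + 1) ^ 3)) := by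
          refine ENNReal.tsum_le_tsum fun l => ?_
          refine ((h l).measure_exists_le ha ha0 has (by positivity)).trans (le_of_eq ?_)
          congr 1
          rw [← hK]
          field_simp
      _ = ENNReal.ofReal (K * T / R) := by
          rw [← ENNReal.ofReal_tsum_of_nonneg (fun l => by positivity) (hl3.mul_left _),
            tsum_mul_left]
          congr 1
          ring
  have hlim : Tendsto (fun R : ℕ => ENNReal.ofReal (K * T / R)) atTop (𝓝 0) := by
    have := ENNReal.tendsto_ofReal (tendsto_const_div_atTop_nhds_zero_nat (K * T))
    simpa using this
  exact le_antisymm (ge_of_tendsto hlim (by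
    filter_upwards [eventually_gt_atTop 0] with R hR using hbound R hR)) zero_le

end Maximal

/-! ### Change of measure for Gaussian increments -/

section Girsanov

lemma lintegral_pi_prod {ι : Type*} [Fintype ι] {X : ι → Type*} [∀ i, MeasurableSpace (X i)]
    (μ : ∀ i, Measure (X i)) [∀ i, IsProbabilityMeasure (μ i)] {f : ∀ i, X i → ℝ≥0∞}
    (hf : ∀ i, Measurable (f i)) :
    ∫⁻ x, ∏ i, f i (x i) ∂(Measure.pi μ) = ∏ i, ∫⁻ x, f i x ∂(μ i) := by
  have h := lintegral_prod_eq_prod_lintegral_of_indepFun Finset.univ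
    (fun i (x : ∀ i, X i) => f i (x i)) (iIndepFun_pi (μ := μ) fun i => (hf i).aemeasurable)
    (fun i => (hf i).comp (measurable_pi_apply i))
  rw [h]
  exact Finset.prod_congr rfl fun i _ => (measurePreserving_eval μ i).lintegral_comp (hf i)

/-- A change of measure that is compensated by a transformation on each factor is compensated on
the product. -/
lemma pi_withDensity_map {ι : Type*} [Fintype ι] {X : ι → Type*} [∀ i, MeasurableSpace (X i)]
    (μ : ∀ i, Measure (X i)) [∀ i, IsProbabilityMeasure (μ i)] {f : ∀ i, X i → ℝ≥0∞}
    (hf : ∀ i, Measurable (f i)) {g : ∀ i, X i → X i} (hg : ∀ i, Measurable (g i))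
    (h : ∀ i, ((μ i).withDensity (f i)).map (g i) = μ i) :
    ((Measure.pi μ).withDensity fun x => ∏ i, f i (x i)).map (fun x i => g i (x i)) =
      Measure.pi μ := by
  have hgm : Measurable fun (x : ∀ i, X i) i => g i (x i) :=
    measurable_pi_lambda _ fun i => (hg i).comp (measurable_pi_apply i)
  refine (Measure.pi_eq fun s hs => ?_).symm
  have hpre : MeasurableSet ((fun (x : ∀ i, X i) i => g i (x i)) ⁻¹' Set.univ.pi s) :=
    hgm (MeasurableSet.univ_pi hs)
  rw [Measure.map_apply hgm (MeasurableSet.univ_pi hs), withDensity_apply _ hpre,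
    ← lintegral_indicator hpre]
  have e : ((fun (x : ∀ i, X i) i => g i (x i)) ⁻¹' Set.univ.pi s).indicator
      (fun x => ∏ i, f i (x i)) = fun x => ∏ i, ((g i ⁻¹' s i).indicator (f i)) (x i) := by
    ext x
    by_cases hx : ∀ i, g i (x i) ∈ s i
    · rw [Set.indicator_of_mem (by simpa using hx)]
      exact Finset.prod_congr rfl fun i _ => by
        rw [Set.indicator_of_mem (show x i ∈ g i ⁻¹' s i from hx i)]
    · rw [Set.indicator_of_notMem (by simpa using hx)]
      push Not at hx
      obtain ⟨i, hi⟩ := hx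
      exact (Finset.prod_eq_zero (Finset.mem_univ i)
        (Set.indicator_of_notMem (show x i ∉ g i ⁻¹' s i from hi) _)).symm
  rw [e, lintegral_pi_prod μ fun i => (hf i).indicator (hg i (hs i))]
  refine Finset.prod_congr rfl fun i _ => ?_
  rw [lintegral_indicator (hg i (hs i)), ← withDensity_apply _ (hg i (hs i)),
    ← Measure.map_apply (hg i) (hs i), h i]

/-- The one-dimensional Cameron–Martin formula. -/
lemma gaussianReal_withDensity_map {v : ℝ≥0} (hv : v ≠ 0) (c : ℝ) :
    ((gaussianReal 0 v).withDensity
      fun x => ENNReal.ofReal (Real.exp (-(c * x) - c ^ 2 * v / 2))).map (fun x => x + v * c) =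
      gaussianReal 0 v := by
  have hv' : (v : ℝ) ≠ 0 := by exact_mod_cast hv
  have hm : Measurable fun x : ℝ => x + v * c := by fun_prop
  ext s hs
  rw [Measure.map_apply hm hs, withDensity_apply _ (hm hs), gaussianReal_of_var_ne_zero _ hv,
    setLIntegral_withDensity_eq_setLIntegral_mul _ (measurable_gaussianPDF 0 v) (by fun_prop)
      (hm hs), withDensity_apply _ hs, ← lintegral_indicator hs, ← lintegral_indicator (hm hs),
    ← lintegral_add_right_eq_self (s.indicator (gaussianPDF 0 v)) (v * c)]
  refine lintegral_congr fun x => ?_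
  by_cases hx : x + v * c ∈ s
  · rw [Set.indicator_of_mem hx,
      Set.indicator_of_mem (show x ∈ (fun x : ℝ => x + v * c) ⁻¹' s from hx), Pi.mul_apply,
      gaussianPDF, gaussianPDF, ← ENNReal.ofReal_mul (gaussianPDFReal_nonneg _ _ _)]
    congr 1
    -- Completing the square: `x²/(2v) + cx + c²v/2 = (x + vc)²/(2v)`.
    rw [gaussianPDFReal, gaussianPDFReal, mul_assoc, ← Real.exp_add]
    congr 2
    field_simp
    ring
  · rw [Set.indicator_of_notMem hx,
      Set.indicator_of_notMem (show x ∉ (fun x : ℝ => x + v * c) ⁻¹' s from hx)]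

variable {q n : ℕ}

/-- The law of `n` independent increments, over time steps of length `h`, of a `q`-dimensional
Brownian motion. -/
def gridMeasure (q n : ℕ) (h : ℝ≥0) : Measure (Fin q → Fin n → ℝ) :=
  Measure.pi fun _ => Measure.pi fun _ => gaussianReal 0 h

instance (h : ℝ≥0) : IsProbabilityMeasure (gridMeasure q n h) := by
  unfold gridMeasure; infer_instance

/-- The sum of all increments. -/
def gridSum (v : Fin q → Fin n → ℝ) : E q := WithLp.toLp 2 fun j => ∑ i, v j i

/-- Increments of the path with additional drift `θ`. -/
def gridShift (h : ℝ≥0) (θ : E q) (v : Fin q → Fin n → ℝ) : Fin q → Fin n → ℝ :=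
  fun j i => v j i + h * θ j

lemma measurable_gridSum : Measurable (gridSum : (Fin q → Fin n → ℝ) → E q) := by
  unfold gridSum
  exact (WithLp.measurable_toLp 2 _).comp (by fun_prop)

lemma measurable_gridShift (h : ℝ≥0) :
    Measurable fun z : E q × (Fin q → Fin n → ℝ) => gridShift h z.1 z.2 := by
  unfold gridShift
  fun_prop

lemma measurable_girsanov {Ω : Type*} [MeasurableSpace Ω] (T : ℝ≥0) {f g : Ω → E q}
    (hf : Measurable f) (hg : Measurable g) : Measurable fun ω => girsanov T (f ω) (g ω) := by
  unfold girsanov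
  fun_prop

/-- The density factorizes over coordinates and time steps, so Girsanov on a grid reduces to the
scalar Cameron–Martin formula. -/
lemma girsanov_gridSum {T h : ℝ≥0} (hT : n * h = T) (v : Fin q → Fin n → ℝ) (θ : E q) :
    girsanov T (gridSum v) θ =
      ∏ j, ∏ i, Real.exp (-(θ j * v j i) - θ j ^ 2 * h / 2) := by
  have hT' : (T : ℝ) = n * h := by rw [← hT]; push_cast; rfl
  simp only [← Real.exp_sum, girsanov]
  congr 1
  rw [EuclideanSpace.norm_sq_eq, PiLp.inner_apply]
  simp only [gridSum, Finset.sum_sub_distrib, Finset.sum_neg_distrib, Finset.sum_const,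
    Finset.card_univ, Fintype.card_fin, hT', Real.norm_eq_abs, sq_abs, RCLike.inner_apply,
    conj_trivial, Finset.sum_mul, Finset.sum_div, nsmul_eq_mul]
  congr 1
  · congr 1
    refine Finset.sum_congr rfl fun j _ => Finset.sum_congr rfl fun i _ => mul_comm _ _
  · refine Finset.sum_congr rfl fun j _ => ?_
    ring

/-- Girsanov's formula for the increments on a grid. -/
lemma lintegral_gridShift_mul_girsanov {T h : ℝ≥0} (hh : h ≠ 0) (hT : n * h = T) (θ : E q)
    {F : (Fin q → Fin n → ℝ) → ℝ≥0∞} (hF : Measurable F) :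
    ∫⁻ v, F (gridShift h θ v) * ENNReal.ofReal (girsanov T (gridSum v) θ) ∂gridMeasure q n h =
      ∫⁻ v, F v ∂gridMeasure q n h := by
  have h1 : ∀ j : Fin q, ((Measure.pi fun _ : Fin n => gaussianReal 0 h).withDensity
      fun x => ∏ i, ENNReal.ofReal (Real.exp (-(θ j * x i) - θ j ^ 2 * h / 2))).map
        (fun x i => x i + h * θ j) = Measure.pi fun _ : Fin n => gaussianReal 0 h := fun j =>
    pi_withDensity_map (fun _ : Fin n => gaussianReal 0 h)
      (f := fun _ x => ENNReal.ofReal (Real.exp (-(θ j * x) - θ j ^ 2 * h / 2)))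
      (fun _ => by fun_prop) (g := fun _ x => x + h * θ j) (fun _ => by fun_prop)
      fun _ => gaussianReal_withDensity_map hh (θ j)
  have h2 : ((gridMeasure q n h).withDensity fun v => ∏ j, ∏ i,
      ENNReal.ofReal (Real.exp (-(θ j * v j i) - θ j ^ 2 * h / 2))).map (gridShift h θ) =
        gridMeasure q n h :=
    pi_withDensity_map (fun _ : Fin q => Measure.pi fun _ : Fin n => gaussianReal 0 h)
      (f := fun j x => ∏ i, ENNReal.ofReal (Real.exp (-(θ j * x i) - θ j ^ 2 * h / 2)))
      (fun _ => by fun_prop) (g := fun j x i => x i + h * θ j) (fun _ => by fun_prop) h1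
  have hsh : Measurable (gridShift (n := n) h θ) :=
    (measurable_gridShift h).comp measurable_prodMk_left
  conv_rhs => rw [← h2]
  have hFs : Measurable fun v => F (gridShift h θ v) := hF.comp hsh
  rw [lintegral_map hF hsh, lintegral_withDensity_eq_lintegral_mul _ (by fun_prop) hFs]
  refine lintegral_congr fun v => ?_
  rw [Pi.mul_apply, mul_comm, girsanov_gridSum hT]
  congr 1
  rw [ENNReal.ofReal_prod_of_nonneg fun j _ => Finset.prod_nonneg fun i _ => (Real.exp_pos _).le]
  exact Finset.prod_congr rfl fun j _ =>
    ENNReal.ofReal_prod_of_nonneg fun i _ => (Real.exp_pos _).le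

end Girsanov

/-! ### The schemes as functions of the increments on a grid -/

section Grid

variable {d q n : ℕ}

/-- A scheme sees its path and parameter only through the drifted increments, so the drift can be
moved into the path. -/
lemma schemePath_congr (Ψ : ℝ → E d → E q → E d) (h : ℝ≥0) (x : E d) {w w' : ℝ≥0 → E q}
    {θ θ' : E q} {k : ℕ}
    (hw : ∀ i < k, w ((i + 1) * h) - w (i * h) + (h : ℝ) • θ =
      w' ((i + 1) * h) - w' (i * h) + (h : ℝ) • θ') :
    schemePath Ψ h x w θ k = schemePath Ψ h x w' θ' k := by
  induction k with
  | zero => rfl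
  | succ k ih =>
    rw [schemePath, schemePath, ih fun i hi => hw i (by omega), hw k (by omega)]

lemma measurable_schemePath {Ω : Type*} [MeasurableSpace Ω] {Ψ : ℝ → E d → E q → E d}
    (hΨ : ∀ h : ℝ, Measurable (Function.uncurry (Ψ h))) (h : ℝ≥0) (x : E d)
    {w : ℝ≥0 → Ω → E q} {θ : Ω → E q} (hθ : Measurable θ) {k : ℕ}
    (hw : ∀ i ≤ k, Measurable (w (i * h))) :
    Measurable fun ω => schemePath Ψ h x (fun t => w t ω) (θ ω) k := by
  induction k with
  | zero => exact measurable_const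
  | succ k ih =>
    have h1 := ih fun i hi => hw i (by omega)
    have h2 : Measurable (w ((k + 1) * h)) := by simpa using hw (k + 1) le_rfl
    have h3 : Measurable (w (k * h)) := hw k (by omega)
    exact (hΨ h).comp (h1.prodMk ((h2.sub h3).add (hθ.const_smul (h : ℝ))))

/-- The path that jumps by the given increments at the grid points of mesh `h`. -/
def gridPath (h : ℝ≥0) (v : Fin q → Fin n → ℝ) (t : ℝ≥0) : E q :=
  WithLp.toLp 2 fun j => ∑ i : Fin n, if ((i : ℕ) + 1) * h ≤ t then v j i else 0

/-- The increments of a path on the grid of mesh `h`. -/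
def gridIncr (n : ℕ) (h : ℝ≥0) (w : ℝ≥0 → E q) : Fin q → Fin n → ℝ :=
  fun j i => w (((i : ℕ) + 1) * h) j - w ((i : ℕ) * h) j

lemma measurable_gridPath (h t : ℝ≥0) :
    Measurable fun v : Fin q → Fin n → ℝ => gridPath h v t := by
  unfold gridPath
  refine (WithLp.measurable_toLp 2 _).comp (measurable_pi_lambda _ fun j =>
    Finset.measurable_sum _ fun i _ => ?_)
  split_ifs <;> fun_prop

lemma sum_fin_ite_lt {k : ℕ} (hk : k ≤ n) (f : ℕ → ℝ) :
    ∑ i : Fin n, (if (i : ℕ) + 1 ≤ k then f i else 0) = ∑ i ∈ Finset.range k, f i := by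
  rw [Fin.sum_univ_eq_sum_range (fun i => if i + 1 ≤ k then f i else 0), ← Finset.sum_filter]
  refine Finset.sum_congr ?_ fun _ _ => rfl
  ext i
  simp only [Finset.mem_filter, Finset.mem_range]
  omega

lemma gridPath_apply {h : ℝ≥0} (hh : 0 < h) (v : Fin q → Fin n → ℝ) (k : ℕ) (j : Fin q) :
    gridPath h v (k * h) j = ∑ i : Fin n, if (i : ℕ) + 1 ≤ k then v j i else 0 := by
  simp only [gridPath]
  refine Finset.sum_congr rfl fun i _ => ?_
  have : ((i : ℕ) + 1 : ℝ≥0) * h ≤ k * h ↔ (i : ℕ) + 1 ≤ k := by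
    rw [mul_le_mul_iff_left₀ hh]
    exact_mod_cast Iff.rfl
  simp only [this]

/-- The path of the shifted increments follows the original path with drift, at grid points. -/
lemma gridPath_gridShift_gridIncr {h : ℝ≥0} (hh : 0 < h) (w : ℝ≥0 → E q) (θ : E q) {k : ℕ}
    (hk : k ≤ n) :
    gridPath h (gridShift h θ (gridIncr n h w)) (k * h) =
      w (k * h) - w 0 + ((k : ℝ) * h) • θ := by
  ext j
  rw [gridPath_apply hh]
  simp only [gridShift, gridIncr]
  rw [sum_fin_ite_lt hk (fun i => w ((i + 1) * h) j - w (i * h) j + h * θ j),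
    Finset.sum_add_distrib]
  have := Finset.sum_range_sub (fun i : ℕ => w (i * h) j) k
  push_cast at this
  rw [this]
  simp
  ring

/-- A coarse step is a union of `c` fine steps, so coarse drifted increments are sums of fine ones.
Taking `c = 1` and `c = M` expresses both schemes of a level through one vector of Gaussian
increments. -/
lemma schemeEnd_eq_gridPath (Ψ : ℝ → E d → E q → E d) {T : ℝ≥0} (hT : 0 < T) (x : E d)
    {n' c : ℕ} (hn : n = n' * c) (hn0 : 0 < n) (w : ℝ≥0 → E q) (θ : E q) :
    schemeEnd Ψ T x n' w θ =
      schemeEnd Ψ T x n' (gridPath (T / n) (gridShift (T / n) θ (gridIncr n (T / n) w))) 0 := by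
  have hn0' : (0 : ℝ≥0) < n := by exact_mod_cast hn0
  have hh : 0 < T / n := by positivity
  have hc : c ≠ 0 := by rintro rfl; simp [hn] at hn0
  have hn'0 : n' ≠ 0 := by rintro rfl; simp [hn] at hn0
  have hstep : T / n' = c * (T / n) := by
    have : (c : ℝ≥0) ≠ 0 := by exact_mod_cast hc
    have : (n' : ℝ≥0) ≠ 0 := by exact_mod_cast hn'0
    rw [hn]; push_cast; field_simp
  refine schemePath_congr Ψ _ x fun i hi => ?_
  have e1 : ((i : ℝ≥0) + 1) * (T / n') = ((i + 1) * c : ℕ) * (T / n) := by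
    rw [hstep]; push_cast; ring
  have e2 : (i : ℝ≥0) * (T / n') = (i * c : ℕ) * (T / n) := by
    rw [hstep]; push_cast; ring
  have l1 : (i + 1) * c ≤ n := by rw [hn]; exact Nat.mul_le_mul_right c hi
  have l2 : i * c ≤ n := by rw [hn]; exact Nat.mul_le_mul_right c hi.le
  rw [e1, e2, gridPath_gridShift_gridIncr hh w θ l1, gridPath_gridShift_gridIncr hh w θ l2]
  have e3 : ((T / n' : ℝ≥0) : ℝ) = c * ((T / n : ℝ≥0) : ℝ) := by rw [hstep]; push_cast; rfl
  rw [e3, smul_zero, add_zero]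
  push_cast
  module

/-- The part of `levelTerm` that does not involve the Girsanov density. -/
def levelPayoff (r : Params) (Ψ : ℝ → E d → E q → E d) (x : E d) (P : E d → ℝ)
    (l : ℕ) (w : ℝ≥0 → E q) (θ : E q) : ℝ :=
  if l = 0 then P (schemeEnd Ψ r.T x (r.steps 0) w θ)
    else P (schemeEnd Ψ r.T x (r.steps l) w θ) - P (schemeEnd Ψ r.T x (r.steps (l - 1)) w θ)

/-- The mesh of the grid of level `l`. -/
def Params.mesh (r : Params) (l : ℕ) : ℝ≥0 := r.T / r.steps l

lemma Params.steps_pos {r : Params} (hM : 2 ≤ r.M) (hm : 1 ≤ r.m) (l : ℕ) : 0 < r.steps l :=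
  Nat.mul_pos (by omega) (Nat.pow_pos (by omega))

lemma Params.mesh_pos {r : Params} (hT : 0 < r.T) (hM : 2 ≤ r.M) (hm : 1 ≤ r.m) (l : ℕ) :
    0 < r.mesh l :=
  div_pos hT (by exact_mod_cast Params.steps_pos hM hm l)

lemma Params.steps_mul_mesh {r : Params} (hM : 2 ≤ r.M) (hm : 1 ≤ r.m) (l : ℕ) :
    r.steps l * r.mesh l = r.T :=
  mul_div_cancel₀ _ (by exact_mod_cast (Params.steps_pos hM hm l).ne')

/-- The payoff on level `l` as a function of the increments on the grid of that level. -/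
def gridPayoff (r : Params) (Ψ : ℝ → E d → E q → E d) (x : E d) (P : E d → ℝ) (l : ℕ)
    (v : Fin q → Fin (r.steps l) → ℝ) : ℝ :=
  levelPayoff r Ψ x P l (gridPath (r.mesh l) v) 0

lemma levelPayoff_eq_gridPayoff {r : Params} (hT : 0 < r.T) (hM : 2 ≤ r.M) (hm : 1 ≤ r.m)
    (Ψ : ℝ → E d → E q → E d) (x : E d) (P : E d → ℝ) (l : ℕ) (w : ℝ≥0 → E q) (θ : E q) :
    levelPayoff r Ψ x P l w θ = gridPayoff r Ψ x P l
      (gridShift (r.mesh l) θ (gridIncr (r.steps l) (r.mesh l) w)) := by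
  have hs := Params.steps_pos hM hm l
  unfold gridPayoff levelPayoff Params.mesh
  rcases Nat.eq_zero_or_pos l with rfl | hl
  · simp only [if_true]
    rw [schemeEnd_eq_gridPath Ψ hT x (mul_one _).symm hs w θ]
  · simp only [hl.ne', if_false]
    rw [schemeEnd_eq_gridPath Ψ hT x (mul_one (r.steps l)).symm hs w θ,
      schemeEnd_eq_gridPath (n' := r.steps (l - 1)) (c := r.M) Ψ hT x ?_ hs w θ]
    obtain ⟨l, rfl⟩ := Nat.exists_eq_succ_of_ne_zero hl.ne'
    simp [Params.steps, pow_succ, mul_assoc]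

lemma measurable_schemeEnd {Ω : Type*} [MeasurableSpace Ω] {Ψ : ℝ → E d → E q → E d}
    (hΨ : ∀ h : ℝ, Measurable (Function.uncurry (Ψ h))) (T : ℝ≥0) (x : E d)
    {w : ℝ≥0 → Ω → E q} {θ : Ω → E q} (hθ : Measurable θ) (k : ℕ)
    (hw : ∀ t ≤ T, Measurable (w t)) :
    Measurable fun ω => schemeEnd Ψ T x k (fun t => w t ω) (θ ω) := by
  refine measurable_schemePath hΨ _ x hθ fun i hi => hw _ ?_
  rcases Nat.eq_zero_or_pos k with rfl | hk
  · simp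
  have hk' : (0 : ℝ≥0) < k := by exact_mod_cast hk
  calc (i : ℝ≥0) * (T / k) ≤ k * (T / k) := by gcongr
    _ = T := mul_div_cancel₀ _ hk'.ne'

lemma measurable_levelPayoff {Ω : Type*} [MeasurableSpace Ω] {Ψ : ℝ → E d → E q → E d}
    (hΨ : ∀ h : ℝ, Measurable (Function.uncurry (Ψ h))) (r : Params) (x : E d)
    {P : E d → ℝ} (hP : Measurable P)
    {w : ℝ≥0 → Ω → E q} {θ : Ω → E q} (hθ : Measurable θ) (l : ℕ)
    (hw : ∀ t ≤ r.T, Measurable (w t)) :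
    Measurable fun ω => levelPayoff r Ψ x P l (fun t => w t ω) (θ ω) := by
  unfold levelPayoff
  split_ifs
  · exact hP.comp (measurable_schemeEnd hΨ _ x hθ _ hw)
  · exact (hP.comp (measurable_schemeEnd hΨ _ x hθ _ hw)).sub
      (hP.comp (measurable_schemeEnd hΨ _ x hθ _ hw))

lemma measurable_levelTerm {Ω : Type*} [MeasurableSpace Ω] {Ψ : ℝ → E d → E q → E d}
    (hΨ : ∀ h : ℝ, Measurable (Function.uncurry (Ψ h))) (r : Params) (x : E d)
    {P : E d → ℝ} (hP : Measurable P)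
    {w : ℝ≥0 → Ω → E q} {θ : Ω → E q} (hθ : Measurable θ) (l : ℕ)
    (hw : ∀ t ≤ r.T, Measurable (w t)) :
    Measurable fun ω => levelTerm r Ψ x P l (fun t => w t ω) (θ ω) := by
  have h1 := measurable_levelPayoff hΨ r x hP hθ l hw
  have h2 : Measurable fun ω => girsanov r.T (w r.T ω) (θ ω) :=
    measurable_girsanov r.T (hw _ le_rfl) hθ
  have h3 : (fun ω => levelTerm r Ψ x P l (fun t => w t ω) (θ ω)) = fun ω =>
      levelPayoff r Ψ x P l (fun t => w t ω) (θ ω) * girsanov r.T (w r.T ω) (θ ω) := rfl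
  rw [h3]
  exact Measurable.mul h1 h2

lemma measurable_gridPayoff {Ψ : ℝ → E d → E q → E d}
    (hΨ : ∀ h : ℝ, Measurable (Function.uncurry (Ψ h))) (r : Params) (x : E d)
    {P : E d → ℝ} (hP : Measurable P) (l : ℕ) : Measurable (gridPayoff r Ψ x P l) :=
  measurable_levelPayoff hΨ r x hP measurable_const l fun t _ => measurable_gridPath _ t

/-- `levelTerm` as a function of the parameter and of the increments on the grid. -/
def gridTerm (r : Params) (Ψ : ℝ → E d → E q → E d) (x : E d) (P : E d → ℝ) (l : ℕ)
    (θ : E q) (v : Fin q → Fin (r.steps l) → ℝ) : ℝ :=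
  gridPayoff r Ψ x P l (gridShift (r.mesh l) θ v) * girsanov r.T (gridSum v) θ

lemma measurable_gridTerm {Ω : Type*} [MeasurableSpace Ω] {Ψ : ℝ → E d → E q → E d}
    (hΨ : ∀ h : ℝ, Measurable (Function.uncurry (Ψ h))) (r : Params) (x : E d)
    {P : E d → ℝ} (hP : Measurable P) (l : ℕ) {f : Ω → E q}
    {g : Ω → (Fin q → Fin (r.steps l) → ℝ)} (hf : Measurable f) (hg : Measurable g) :
    Measurable fun ω => gridTerm r Ψ x P l (f ω) (g ω) := by
  have h1 : Measurable fun ω => gridPayoff r Ψ x P l (gridShift (r.mesh l) (f ω) (g ω)) :=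
    (measurable_gridPayoff hΨ r x hP l).comp
      ((measurable_gridShift (r.mesh l)).comp (hf.prodMk hg))
  have h2 : Measurable fun ω => girsanov r.T (gridSum (g ω)) (f ω) :=
    measurable_girsanov r.T (measurable_gridSum.comp hg) hf
  unfold gridTerm
  exact Measurable.mul h1 h2

lemma gridSum_gridIncr {r : Params} (hM : 2 ≤ r.M) (hm : 1 ≤ r.m) (l : ℕ) (w : ℝ≥0 → E q) :
    gridSum (gridIncr (r.steps l) (r.mesh l) w) = w r.T - w 0 := by
  ext j
  simp only [gridSum, gridIncr]
  have := Finset.sum_range_sub (fun i : ℕ => w (i * r.mesh l) j) (r.steps l)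
  push_cast at this
  rw [Fin.sum_univ_eq_sum_range
    (fun i => w ((i + 1) * r.mesh l) j - w (i * r.mesh l) j) (r.steps l), this,
    Params.steps_mul_mesh hM hm]
  simp

/-- The density uses `w T`, whereas the increments only sum to `w T - w 0`; hence the condition at
time `0`. -/
lemma levelTerm_eq_gridTerm {r : Params} (hT : 0 < r.T) (hM : 2 ≤ r.M) (hm : 1 ≤ r.m)
    (Ψ : ℝ → E d → E q → E d) (x : E d) (P : E d → ℝ) (l : ℕ) {w : ℝ≥0 → E q} (hw : w 0 = 0)
    (θ : E q) :
    levelTerm r Ψ x P l w θ =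
      gridTerm r Ψ x P l θ (gridIncr (r.steps l) (r.mesh l) w) := by
  rw [gridTerm, ← levelPayoff_eq_gridPayoff hT hM hm, gridSum_gridIncr hM hm, hw, sub_zero]
  rfl

end Grid

/-! ### Brownian increments -/

section BrownianIncrements

variable {Ω : Type*} {q : ℕ} {T : ℝ≥0}

lemma measurable_gridIncr {m : MeasurableSpace Ω} {n : ℕ} {h : ℝ≥0} (hT : n * h ≤ T)
    {W : ℝ≥0 → Ω → E q} (hW : ∀ t ≤ T, Measurable[m] (W t)) :
    Measurable[m] fun ω => gridIncr n h (fun t => W t ω) := by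
  have hle : ∀ k : ℕ, k ≤ n → (k : ℝ≥0) * h ≤ T := fun k hk =>
    le_trans (by gcongr) hT
  refine measurable_pi_lambda _ fun j => measurable_pi_lambda _ fun i => ?_
  have h1 := hW _ (hle (i + 1) i.2)
  have h2 := hW _ (hle i i.2.le)
  push_cast at h1
  have hc : Measurable fun y : E q => y j := by fun_prop
  exact (hc.comp h1).sub (hc.comp h2)

lemma measurable_pathSigma (W : ℝ≥0 → Ω → E q) {t : ℝ≥0} (ht : t ≤ T) :
    Measurable[pathSigma T W] (W t) :=
  Measurable.mono (comap_measurable (W t)) (le_iSup₂_of_le t ht le_rfl) le_rfl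

lemma pathSigma_le_pastSigma (W : ℕ → ℕ → ℝ≥0 → Ω → E q) (l : ℕ) {j k : ℕ} (hjk : j < k) :
    pathSigma T (W l j) ≤ pastSigma T W k :=
  le_iSup_of_le l (le_iSup₂_of_le j hjk le_rfl)

lemma pastSigma_mono (W : ℕ → ℕ → ℝ≥0 → Ω → E q) : Monotone (pastSigma T W) := fun _ _ hab =>
  iSup_le fun l => iSup₂_le fun _ hj => pathSigma_le_pastSigma W l (hj.trans_le hab)

variable [mΩ : MeasurableSpace Ω] {μ : Measure Ω}

lemma IsBrownianMotion.ae_zero {W : ℝ≥0 → Ω → E q} (hW : IsBrownianMotion W μ) :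
    ∀ᵐ ω ∂μ, W 0 ω = 0 := by
  have : ∀ᵐ ω ∂μ, ∀ j : Fin q, W 0 ω j = 0 :=
    ae_all_iff.2 fun j => (hW.coord j).eval_zero_ae_eq_zero
  filter_upwards [this] with ω hω
  ext j
  exact hω j

/-- The law of the increments of a Brownian motion. -/
lemma IsBrownianMotion.map_gridIncr {W : ℝ≥0 → Ω → E q}
    (hW : IsBrownianMotion W μ) (n : ℕ) (h : ℝ≥0) :
    μ.map (fun ω => gridIncr n h (fun t => W t ω)) = gridMeasure q n h := by
  have hcoord : ∀ j : Fin q, HasLaw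
      (fun ω (i : Fin n) => W (((i : ℕ) + 1) * h) ω j - W ((i : ℕ) * h) ω j)
      (Measure.pi fun _ : Fin n => gaussianReal 0 h) μ := by
    intro j
    refine iIndepFun.hasLaw_pi (fun i => ?_) ?_
    · have := (hW.coord j).hasLaw_sub (((i : ℕ) + 1) * h) ((i : ℕ) * h)
      have e : nndist (((((i : ℕ) + 1) * h : ℝ≥0)) : ℝ) ((((i : ℕ) * h : ℝ≥0)) : ℝ) = h := by
        ext
        rw [coe_nndist, Real.dist_eq]
        push_cast
        rw [show ((i : ℕ) + 1 : ℝ) * h - (i : ℕ) * h = h by ring, NNReal.abs_eq]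
      erw [e] at this
      exact this
    · have hmono : Monotone fun i : ℕ => (i : ℝ≥0) * h := fun a b hab => by
        dsimp only; gcongr
      have := ((hW.coord j).hasIndepIncrements.nat hmono).precomp
        (Fin.val_injective (n := n))
      push_cast at this
      exact this
  have hind : iIndepFun (fun (j : Fin q) ω (i : Fin n) =>
      W (((i : ℕ) + 1) * h) ω j - W ((i : ℕ) * h) ω j) μ :=
    hW.indep.comp (fun (_ : Fin q) (f : ℝ≥0 → ℝ) (i : Fin n) =>
      f (((i : ℕ) + 1) * h) - f ((i : ℕ) * h)) fun j => by fun_prop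
  exact (hind.hasLaw_pi hcoord).map_eq

lemma pathSigma_le {W : ℝ≥0 → Ω → E q} (hW : ∀ t, Measurable (W t)) : pathSigma T W ≤ mΩ :=
  iSup₂_le fun t _ => (hW t).comap_le

lemma pastSigma_le {W : ℕ → ℕ → ℝ≥0 → Ω → E q} (hW : ∀ l k t, Measurable (W l k t)) (k : ℕ) :
    pastSigma T W k ≤ mΩ :=
  iSup_le fun l => iSup₂_le fun j _ => pathSigma_le (hW l j)

/-- The past is independent of the present sample path. -/
lemma indep_pastSigma {W : ℕ → ℕ → ℝ≥0 → Ω → E q} (hW : ∀ l k t, Measurable (W l k t))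
    (hWindep : iIndep (fun i : ℕ × ℕ => pathSigma T (W i.1 i.2)) μ) (l k : ℕ) :
    Indep (pastSigma T W k) (pathSigma T (W l k)) μ := by
  have h := indep_iSup_of_disjoint (fun i : ℕ × ℕ => pathSigma_le (T := T) (hW i.1 i.2)) hWindep
    (S := {i : ℕ × ℕ | i.2 < k}) (T := {(l, k)}) (by simp)
  refine indep_of_indep_of_le_left (indep_of_indep_of_le_right h ?_) ?_
  · simp
  · exact iSup_le fun l' => iSup₂_le fun j hj =>
      le_iSup₂_of_le (f := fun (i : ℕ × ℕ) (_ : i ∈ {i : ℕ × ℕ | i.2 < k}) =>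
        pathSigma T (W i.1 i.2)) (l', j) hj le_rfl

end BrownianIncrements

/-! ### Moments of the level terms -/

section Moments

lemma integrable_of_lintegral_sq {α : Type*} [MeasurableSpace α] {μ : Measure α}
    [IsFiniteMeasure μ] {f : α → ℝ} (hf : Measurable f)
    (h : ∫⁻ x, ENNReal.ofReal (f x ^ 2) ∂μ < ∞) : Integrable f μ := by
  have h2 : Integrable (fun x => f x ^ 2) μ := by
    refine ⟨(hf.pow_const 2).aestronglyMeasurable, ?_⟩
    rwa [hasFiniteIntegral_iff_ofReal (.of_forall fun x => sq_nonneg _)]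
  refine Integrable.mono' ((integrable_const (1 : ℝ)).add h2) hf.aestronglyMeasurable
    (.of_forall fun x => ?_)
  simp only [Pi.add_apply, Real.norm_eq_abs]
  nlinarith [sq_nonneg (|f x| - 1), sq_abs (f x)]

lemma lintegral_sq_sub_le {α : Type*} [MeasurableSpace α] (μ : Measure α) {f g : α → ℝ}
    (hf : Measurable f) :
    ∫⁻ x, ENNReal.ofReal ((f x - g x) ^ 2) ∂μ ≤
      2 * ∫⁻ x, ENNReal.ofReal (f x ^ 2) ∂μ + 2 * ∫⁻ x, ENNReal.ofReal (g x ^ 2) ∂μ := by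
  rw [← lintegral_const_mul' _ _ (by simp), ← lintegral_const_mul' _ _ (by simp),
    ← lintegral_add_left (by fun_prop)]
  refine lintegral_mono fun x => ?_
  have h2 : (2 : ℝ≥0∞) = ENNReal.ofReal 2 := by simp
  rw [h2, ← ENNReal.ofReal_mul (by norm_num), ← ENNReal.ofReal_mul (by norm_num),
    ← ENNReal.ofReal_add (by positivity) (by positivity)]
  exact ENNReal.ofReal_le_ofReal (by nlinarith [sq_nonneg (f x + g x)])

lemma ofReal_sq_le_one_add_enorm_rpow {p : ℝ} (hp : 2 ≤ p) (x : ℝ) :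
    ENNReal.ofReal (x ^ 2) ≤ 1 + ‖x‖ₑ ^ p := by
  have h : x ^ 2 ≤ 1 + |x| ^ p := by
    rcases le_total |x| 1 with h | h
    · have : x ^ 2 ≤ 1 := by rw [← sq_abs]; nlinarith [abs_nonneg x]
      have : 0 ≤ |x| ^ p := by positivity
      linarith
    · have : |x| ^ (2 : ℝ) ≤ |x| ^ p := Real.rpow_le_rpow_of_exponent_le h hp
      rw [Real.rpow_two, sq_abs] at this
      linarith
  refine (ENNReal.ofReal_le_ofReal h).trans ?_
  rw [ENNReal.ofReal_add zero_le_one (by positivity), ENNReal.ofReal_one,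
    ← ENNReal.ofReal_rpow_of_nonneg (abs_nonneg x) (by linarith), ← Real.norm_eq_abs,
    ofReal_norm]

lemma girsanov_pos {q : ℕ} (T : ℝ≥0) (w θ : E q) : 0 < girsanov T w θ := Real.exp_pos _

/-- Expresses the squared density through the drifted path, so that after the change of measure it
becomes a constant times a density of mean one. -/
lemma girsanov_sq {q : ℕ} (T : ℝ≥0) (w θ : E q) :
    girsanov T w θ ^ 2 =
      Real.exp (3 * ‖θ‖ ^ 2 * T) * girsanov T (w + (T : ℝ) • θ) ((2 : ℝ) • θ) := by
  rw [girsanov, girsanov, ← Real.exp_add, ← Real.exp_nat_mul]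
  congr 1
  rw [inner_smul_left, inner_add_right, inner_smul_right, real_inner_self_eq_norm_sq, norm_smul]
  simp
  ring

/-- A Young-type inequality that leaves one factor `b` outside. With `b` the Girsanov density, that
factor is spent on the change of measure. This is why the order `3/2` suits payoffs with only two
moments. -/
lemma absPow_mul_of_pos (a : ℝ) {b : ℝ} (hb : 0 < b) :
    absPow (a * b) ≤ (a ^ 2 + b ^ 2) * b := by
  rw [absPow_eq, abs_mul, Real.sqrt_mul (abs_nonneg a), abs_of_pos hb]
  set u := √|a|
  set y := √b
  have hu : 0 ≤ u := Real.sqrt_nonneg _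
  have hy : 0 ≤ y := Real.sqrt_nonneg _
  have ha2 : a ^ 2 = u ^ 4 := by
    rw [show u ^ 4 = (u ^ 2) ^ 2 by ring, Real.sq_sqrt (abs_nonneg a), sq_abs]
  have hb2 : b = y ^ 2 := (Real.sq_sqrt hb.le).symm
  rw [ha2, hb2]
  have key : u ^ 3 * y ≤ u ^ 4 + y ^ 4 := by
    nlinarith [sq_nonneg (u ^ 2 - u * y), sq_nonneg (u * y), sq_nonneg (u ^ 2 - y ^ 2),
      sq_nonneg (u ^ 2), sq_nonneg (y ^ 2)]
  calc (u * y) ^ 3 = (u ^ 3 * y) * y ^ 2 := by ring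
    _ ≤ (u ^ 4 + y ^ 4) * y ^ 2 := by gcongr
    _ = (u ^ 4 + (y ^ 2) ^ 2) * y ^ 2 := by ring

variable {d q : ℕ} {r : Params} {Ψ : ℝ → E d → E q → E d} {x : E d} {P : E d → ℝ}

lemma gridSum_gridShift {n : ℕ} {h T : ℝ≥0} (hT : n * h = T) (θ : E q)
    (v : Fin q → Fin n → ℝ) : gridSum (gridShift h θ v) = gridSum v + (T : ℝ) • θ := by
  ext j
  have hT' : (T : ℝ) = n * h := by rw [← hT]; push_cast; rfl
  simp [gridSum, gridShift, Finset.sum_add_distrib, hT', mul_assoc]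

/-- The moment of order `3/2` of a level term, for a fixed parameter. -/
lemma lintegral_absPow_gridTerm_le (hT : 0 < r.T) (hM : 2 ≤ r.M) (hm : 1 ≤ r.m)
    (hΨ : ∀ h : ℝ, Measurable (Function.uncurry (Ψ h))) (hP : Measurable P) (l : ℕ) (θ : E q) :
    ∫⁻ v, ENNReal.ofReal (absPow (gridTerm r Ψ x P l θ v)) ∂gridMeasure q (r.steps l) (r.mesh l) ≤
      ∫⁻ v, ENNReal.ofReal (gridPayoff r Ψ x P l v ^ 2) ∂gridMeasure q (r.steps l) (r.mesh l) +
        ENNReal.ofReal (Real.exp (3 * ‖θ‖ ^ 2 * r.T)) := by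
  have hh := (Params.mesh_pos hT hM hm l).ne'
  have hs := Params.steps_mul_mesh (r := r) hM hm l
  have hG := measurable_gridPayoff hΨ r x hP l
  have hJ : ∀ θ : E q, Measurable fun v : Fin q → Fin (r.steps l) → ℝ =>
      ENNReal.ofReal (girsanov r.T (gridSum v) θ) := fun θ =>
    (measurable_girsanov r.T measurable_gridSum measurable_const).ennreal_ofReal
  have hone : ∫⁻ v, ENNReal.ofReal (girsanov r.T (gridSum v) ((2 : ℝ) • θ))
      ∂gridMeasure q (r.steps l) (r.mesh l) = 1 := by
    have := lintegral_gridShift_mul_girsanov hh hs ((2 : ℝ) • θ) (F := fun _ => 1)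
      measurable_const
    simpa using this
  set F : (Fin q → Fin (r.steps l) → ℝ) → ℝ≥0∞ := fun v =>
    ENNReal.ofReal (gridPayoff r Ψ x P l v ^ 2) + ENNReal.ofReal (Real.exp (3 * ‖θ‖ ^ 2 * r.T)) *
      ENNReal.ofReal (girsanov r.T (gridSum v) ((2 : ℝ) • θ)) with hF
  have hFm : Measurable F :=
    (hG.pow_const 2).ennreal_ofReal.add ((hJ ((2 : ℝ) • θ)).const_mul _)
  calc _ ≤ ∫⁻ v, F (gridShift (r.mesh l) θ v) * ENNReal.ofReal (girsanov r.T (gridSum v) θ)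
        ∂gridMeasure q (r.steps l) (r.mesh l) := by
        refine lintegral_mono fun v => ?_
        simp only [hF, gridTerm]
        rw [gridSum_gridShift hs, ← ENNReal.ofReal_mul (Real.exp_pos _).le, ← girsanov_sq,
          ← ENNReal.ofReal_add (sq_nonneg _) (sq_nonneg _),
          ← ENNReal.ofReal_mul (add_nonneg (sq_nonneg _) (sq_nonneg _))]
        exact ENNReal.ofReal_le_ofReal (absPow_mul_of_pos _ (girsanov_pos _ _ _))
    _ = ∫⁻ v, F v ∂gridMeasure q (r.steps l) (r.mesh l) :=
        lintegral_gridShift_mul_girsanov hh hs θ hFm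
    _ = _ := by
        rw [hF, lintegral_add_left (hG.pow_const 2).ennreal_ofReal,
          lintegral_const_mul _ (hJ _), hone, mul_one]

/-- Positive homogeneity lets the density be pulled out of `φ`. Applied to the modulus it gives
integrability, and to `±` the identity it gives the positive and negative parts of the mean. -/
lemma lintegral_ofReal_gridTerm (hT : 0 < r.T) (hM : 2 ≤ r.M) (hm : 1 ≤ r.m)
    (hΨ : ∀ h : ℝ, Measurable (Function.uncurry (Ψ h))) (hP : Measurable P) (l : ℕ) (θ : E q)
    {φ : ℝ → ℝ} (hφ : Measurable φ) (hφmul : ∀ a b : ℝ, 0 < b → φ (a * b) = φ a * b) :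
    ∫⁻ v, ENNReal.ofReal (φ (gridTerm r Ψ x P l θ v)) ∂gridMeasure q (r.steps l) (r.mesh l) =
      ∫⁻ v, ENNReal.ofReal (φ (gridPayoff r Ψ x P l v))
        ∂gridMeasure q (r.steps l) (r.mesh l) := by
  rw [← lintegral_gridShift_mul_girsanov (Params.mesh_pos hT hM hm l).ne'
    (Params.steps_mul_mesh (r := r) hM hm l) θ
    (F := fun v => ENNReal.ofReal (φ (gridPayoff r Ψ x P l v)))
    (hφ.comp (measurable_gridPayoff hΨ r x hP l)).ennreal_ofReal]
  refine lintegral_congr fun v => ?_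
  rw [gridTerm, hφmul _ _ (girsanov_pos _ _ _), ENNReal.ofReal_mul' (girsanov_pos _ _ _).le]

/-- Importance sampling does not change the mean. -/
lemma integral_gridTerm (hT : 0 < r.T) (hM : 2 ≤ r.M) (hm : 1 ≤ r.m)
    (hΨ : ∀ h : ℝ, Measurable (Function.uncurry (Ψ h))) (hP : Measurable P) (l : ℕ) (θ : E q)
    (hG : Integrable (gridPayoff r Ψ x P l) (gridMeasure q (r.steps l) (r.mesh l))) :
    ∫ v, gridTerm r Ψ x P l θ v ∂gridMeasure q (r.steps l) (r.mesh l) =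
      ∫ v, gridPayoff r Ψ x P l v ∂gridMeasure q (r.steps l) (r.mesh l) := by
  have habs := lintegral_ofReal_gridTerm (x := x) hT hM hm hΨ hP l θ (φ := fun y => |y|)
    (by fun_prop) (fun a b hb => by rw [abs_mul, abs_of_pos hb])
  have hZm : Measurable (gridTerm r Ψ x P l θ) :=
    measurable_gridTerm hΨ r x hP l measurable_const measurable_id
  have hZ : Integrable (gridTerm r Ψ x P l θ) (gridMeasure q (r.steps l) (r.mesh l)) := by
    refine ⟨hZm.aestronglyMeasurable, ?_⟩
    rw [hasFiniteIntegral_iff_norm]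
    have := hG.2
    rw [hasFiniteIntegral_iff_norm] at this
    simp only [Real.norm_eq_abs] at this ⊢
    rwa [habs]
  rw [integral_eq_lintegral_pos_part_sub_lintegral_neg_part hZ,
    integral_eq_lintegral_pos_part_sub_lintegral_neg_part hG,
    lintegral_ofReal_gridTerm hT hM hm hΨ hP l θ (φ := fun y => y) measurable_id
      (fun a b _ => rfl),
    lintegral_ofReal_gridTerm hT hM hm hΨ hP l θ (φ := fun y => -y) measurable_neg
      (fun a b _ => by ring)]

end Moments

/-! ### The level terms as martingale increments -/

section Increments

variable {Ω : Type*} [mΩ : MeasurableSpace Ω] {μ : Measure Ω} [IsProbabilityMeasure μ]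

lemma IndepFun.lintegral_prodMk {α V : Type*} [MeasurableSpace α] [MeasurableSpace V]
    {Y : Ω → α} {H : Ω → V} (hY : Measurable Y) (hH : Measurable H) (hind : IndepFun Y H μ)
    {F : α × V → ℝ≥0∞} (hF : Measurable F) :
    ∫⁻ ω, F (Y ω, H ω) ∂μ = ∫⁻ ω, ∫⁻ v, F (Y ω, v) ∂(μ.map H) ∂μ := by
  rw [← lintegral_map hF (hY.prodMk hH),
    (indepFun_iff_map_prod_eq_prod_map_map hY.aemeasurable hH.aemeasurable).1 hind,
    lintegral_prod _ hF.aemeasurable, lintegral_map hF.lintegral_prod_right' hY]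

lemma IndepFun.integral_prodMk {α V : Type*} [MeasurableSpace α] [MeasurableSpace V]
    {Y : Ω → α} {H : Ω → V} (hY : Measurable Y) (hH : Measurable H) (hind : IndepFun Y H μ)
    {F : α × V → ℝ} (hF : Measurable F) (hi : Integrable (fun ω => F (Y ω, H ω)) μ) :
    ∫ ω, F (Y ω, H ω) ∂μ = ∫ ω, ∫ v, F (Y ω, v) ∂(μ.map H) ∂μ := by
  have hmap := (indepFun_iff_map_prod_eq_prod_map_map hY.aemeasurable hH.aemeasurable).1 hind
  have hi' : Integrable F ((μ.map Y).prod (μ.map H)) := by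
    rw [← hmap, integrable_map_measure hF.aestronglyMeasurable (hY.prodMk hH).aemeasurable]
    exact hi
  rw [← integral_map (hY.prodMk hH).aemeasurable hF.aestronglyMeasurable, hmap,
    integral_prod _ hi', integral_map hY.aemeasurable
      hF.stronglyMeasurable.integral_prod_right'.aestronglyMeasurable]

variable {d q : ℕ} {r : Params} {Ψ : ℝ → E d → E q → E d} {x : E d} {P : E d → ℝ}

/-- The mean of the payoff on level `l`. -/
def levelMean (q : ℕ) (r : Params) (Ψ : ℝ → E d → E q → E d) (x : E d) (P : E d → ℝ) (l : ℕ) : ℝ :=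
  ∫ v, gridPayoff r Ψ x P l v ∂gridMeasure q (r.steps l) (r.mesh l)

lemma abs_levelMean_le (hΨ : ∀ h : ℝ, Measurable (Function.uncurry (Ψ h))) (hP : Measurable P)
    {C₂ : ℝ≥0} {l : ℕ} (hC₂ : ∫⁻ v, ENNReal.ofReal (gridPayoff r Ψ x P l v ^ 2)
      ∂gridMeasure q (r.steps l) (r.mesh l) ≤ C₂) :
    |levelMean q r Ψ x P l| ≤ 1 + C₂ := by
  have hG := measurable_gridPayoff hΨ r x hP l
  have h2 : Integrable (fun v => gridPayoff r Ψ x P l v ^ 2)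
      (gridMeasure q (r.steps l) (r.mesh l)) := by
    refine ⟨(hG.pow_const 2).aestronglyMeasurable, ?_⟩
    rw [hasFiniteIntegral_iff_ofReal (.of_forall fun x => sq_nonneg _)]
    exact hC₂.trans_lt ENNReal.coe_lt_top
  have h3 : ∫ v, gridPayoff r Ψ x P l v ^ 2 ∂gridMeasure q (r.steps l) (r.mesh l) ≤ C₂ := by
    rw [integral_eq_lintegral_of_nonneg_ae (.of_forall fun x => sq_nonneg _)
      (hG.pow_const 2).aestronglyMeasurable]
    exact ENNReal.toReal_le_coe_of_le_coe hC₂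
  calc |levelMean q r Ψ x P l| ≤
        ∫ v, (1 + gridPayoff r Ψ x P l v ^ 2) ∂gridMeasure q (r.steps l) (r.mesh l) := by
        rw [← Real.norm_eq_abs, levelMean]
        refine norm_integral_le_of_norm_le ((integrable_const (1 : ℝ)).add h2)
          (.of_forall fun v => ?_)
        rw [Real.norm_eq_abs]
        nlinarith [sq_nonneg (|gridPayoff r Ψ x P l v| - 1), sq_abs (gridPayoff r Ψ x P l v)]
    _ ≤ 1 + C₂ := by
        rw [integral_add (integrable_const (1 : ℝ)) h2]
        simp only [integral_const, probReal_univ, one_smul]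
        linarith

/-- The centered level terms are martingale increments with uniformly bounded moments of order
`3/2`. -/
lemma isMartingaleIncrement_levelTerm (hT : 0 < r.T) (hM : 2 ≤ r.M) (hm : 1 ≤ r.m)
    (hΨ : ∀ h : ℝ, Measurable (Function.uncurry (Ψ h))) (hP : Measurable P)
    {W : ℕ → ℕ → ℝ≥0 → Ω → E q} (hW : ∀ l k, IsBrownianMotion (W l k) μ)
    (hWindep : iIndep (fun i : ℕ × ℕ => pathSigma r.T (W i.1 i.2)) μ)
    {θ : ℕ → ℕ → Ω → E q} {K : ℝ} (hθK : ∀ l k ω, ‖θ l k ω‖ ≤ K)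
    (hθmeas : ∀ l k, Measurable[pastSigma r.T W k] (θ l k))
    {C₂ : ℝ≥0} (l : ℕ) (hC₂ : ∫⁻ v, ENNReal.ofReal (gridPayoff r Ψ x P l v ^ 2)
      ∂gridMeasure q (r.steps l) (r.mesh l) ≤ C₂) :
    IsMartingaleIncrement (pastSigma r.T W)
      (fun k ω => levelTerm r Ψ x P l (fun t => W l k t ω) (θ l k ω) - levelMean q r Ψ x P l)
      (4 * (C₂ + Real.exp (3 * K ^ 2 * r.T) + absPow (1 + C₂))) μ := by
  have hWm : ∀ l k t, Measurable (W l k t) := fun l k t => (hW l k).measurable t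
  have hle := pastSigma_le (T := r.T) hWm
  have hmono := pastSigma_mono (T := r.T) W
  have hs := Params.steps_mul_mesh (r := r) hM hm l
  set γ := gridMeasure q (r.steps l) (r.mesh l) with hγ
  set H : ℕ → Ω → (Fin q → Fin (r.steps l) → ℝ) :=
    fun k ω => gridIncr (r.steps l) (r.mesh l) (fun t => W l k t ω) with hH
  have hHm : ∀ k, Measurable[pathSigma r.T (W l k)] (H k) := fun k =>
    measurable_gridIncr hs.le fun t ht => measurable_pathSigma (W l k) ht
  have hHm' : ∀ k, Measurable (H k) := fun k => (hHm k).mono (pathSigma_le (hWm l k)) le_rfl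
  have hHlaw : ∀ k, μ.map (H k) = γ := fun k => (hW l k).map_gridIncr _ _
  have hθm : ∀ k, Measurable (θ l k) := fun k => (hθmeas l k).mono (hle k) le_rfl
  -- Only almost everywhere, because a Brownian motion starts at zero only almost surely.
  have hlt : ∀ k, (fun ω => levelTerm r Ψ x P l (fun t => W l k t ω) (θ l k ω)) =ᵐ[μ]
      fun ω => gridTerm r Ψ x P l (θ l k ω) (H k ω) := fun k => by
    filter_upwards [(hW l k).ae_zero] with ω hω
    exact levelTerm_eq_gridTerm hT hM hm Ψ x P l hω (θ l k ω)
  have hltm : ∀ k, Measurable[pastSigma r.T W (k + 1)]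
      fun ω => levelTerm r Ψ x P l (fun t => W l k t ω) (θ l k ω) := fun k =>
    @measurable_levelTerm d q Ω (pastSigma r.T W (k + 1)) Ψ hΨ r x P hP (W l k) (θ l k)
      ((hθmeas l k).mono (hmono (Nat.le_succ k)) le_rfl) l fun t ht =>
        (measurable_pathSigma (W l k) ht).mono
          (pathSigma_le_pastSigma W l (Nat.lt_succ_self k)) le_rfl
  have hZm : Measurable fun z : E q × (Fin q → Fin (r.steps l) → ℝ) =>
      gridTerm r Ψ x P l z.1 z.2 := measurable_gridTerm hΨ r x hP l measurable_fst measurable_snd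
  -- Generic in `Y`, since it serves both the parameter alone and the pair of a test variable and
  -- the parameter.
  have hindep : ∀ k {α : Type} [MeasurableSpace α] (Y : Ω → α),
      Measurable[pastSigma r.T W k] Y → IndepFun Y (H k) μ := by
    intro k α _ Y hY
    rw [IndepFun_iff_Indep]
    exact indep_of_indep_of_le_left (indep_of_indep_of_le_right
      (indep_pastSigma hWm hWindep l k) (hHm k).comap_le) hY.comap_le
  have hGi : Integrable (gridPayoff r Ψ x P l) γ :=
    integrable_of_lintegral_sq (measurable_gridPayoff hΨ r x hP l)
      (hC₂.trans_lt ENNReal.coe_lt_top)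
  have hGabs : ∫⁻ v, ENNReal.ofReal |gridPayoff r Ψ x P l v| ∂γ < ∞ := by
    have := hGi.2
    rwa [hasFiniteIntegral_iff_norm] at this
  -- moments of order `3/2`
  have hmom : ∀ k, ∫⁻ ω, ENNReal.ofReal (absPow (gridTerm r Ψ x P l (θ l k ω) (H k ω))) ∂μ ≤
      ENNReal.ofReal (C₂ + Real.exp (3 * K ^ 2 * r.T)) := by
    intro k
    rw [IndepFun.lintegral_prodMk (hθm k) (hHm' k) (hindep k _ (hθmeas l k))
      (F := fun z => ENNReal.ofReal (absPow (gridTerm r Ψ x P l z.1 z.2)))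
      (measurable_absPow.comp hZm).ennreal_ofReal, hHlaw]
    calc _ ≤ ∫⁻ _, ENNReal.ofReal (C₂ + Real.exp (3 * K ^ 2 * r.T)) ∂μ := by
          refine lintegral_mono fun ω => ?_
          refine (lintegral_absPow_gridTerm_le hT hM hm hΨ hP l (θ l k ω)).trans ?_
          rw [ENNReal.ofReal_add C₂.coe_nonneg (Real.exp_pos _).le]
          refine add_le_add (hC₂.trans (by simp)) (ENNReal.ofReal_le_ofReal ?_)
          have := hθK l k ω
          have := norm_nonneg (θ l k ω)
          gcongr
      _ = _ := by simp
  have hZpow : ∀ k, Integrable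
      (fun ω => absPow (levelTerm r Ψ x P l (fun t => W l k t ω) (θ l k ω))) μ ∧
      ∫ ω, absPow (levelTerm r Ψ x P l (fun t => W l k t ω) (θ l k ω)) ∂μ ≤
        C₂ + Real.exp (3 * K ^ 2 * r.T) := by
    intro k
    have hme : AEStronglyMeasurable
        (fun ω => absPow (levelTerm r Ψ x P l (fun t => W l k t ω) (θ l k ω))) μ :=
      (measurable_absPow.comp ((hltm k).mono (hle _) le_rfl)).aestronglyMeasurable
    have hli : ∫⁻ ω, ENNReal.ofReal
        (absPow (levelTerm r Ψ x P l (fun t => W l k t ω) (θ l k ω))) ∂μ ≤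
          ENNReal.ofReal (C₂ + Real.exp (3 * K ^ 2 * r.T)) := by
      refine (le_of_eq (lintegral_congr_ae ?_)).trans (hmom k)
      filter_upwards [hlt k] with ω hω
      rw [hω]
    refine ⟨⟨hme, ?_⟩, ?_⟩
    · rw [hasFiniteIntegral_iff_ofReal (.of_forall fun _ => absPow_nonneg _)]
      exact hli.trans_lt ENNReal.ofReal_lt_top
    · rw [integral_eq_lintegral_of_nonneg_ae (.of_forall fun _ => absPow_nonneg _) hme]
      exact ENNReal.toReal_le_of_le_ofReal (by positivity) hli
  have hDle : ∀ k ω, absPow (levelTerm r Ψ x P l (fun t => W l k t ω) (θ l k ω) -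
      levelMean q r Ψ x P l) ≤ 4 * (absPow (levelTerm r Ψ x P l (fun t => W l k t ω) (θ l k ω)) +
        absPow (1 + C₂)) := by
    intro k ω
    rw [sub_eq_add_neg]
    refine (absPow_add_le_four _ _).trans ?_
    have : absPow (-levelMean q r Ψ x P l) ≤ absPow (1 + C₂) := by
      unfold absPow
      rw [abs_neg, abs_of_nonneg (by positivity : (0 : ℝ) ≤ 1 + C₂)]
      have := abs_levelMean_le hΨ hP hC₂
      gcongr
    linarith
  have hDm : ∀ k, Measurable[pastSigma r.T W (k + 1)] fun ω =>
      levelTerm r Ψ x P l (fun t => W l k t ω) (θ l k ω) - levelMean q r Ψ x P l :=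
    fun k => (hltm k).sub measurable_const
  have hDbound : ∀ k, Integrable (fun ω =>
      4 * (absPow (levelTerm r Ψ x P l (fun t => W l k t ω) (θ l k ω)) + absPow (1 + C₂))) μ :=
    fun k => ((hZpow k).1.add (integrable_const _)).const_mul 4
  have hDpow : ∀ k, Integrable (fun ω => absPow
      (levelTerm r Ψ x P l (fun t => W l k t ω) (θ l k ω) - levelMean q r Ψ x P l)) μ := fun k =>
    (hDbound k).mono' (measurable_absPow.comp ((hDm k).mono (hle _) le_rfl)).aestronglyMeasurable
      (.of_forall fun ω => by
        rw [Real.norm_of_nonneg (absPow_nonneg _)]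
        exact hDle k ω)
  -- products with random variables of the past
  have hmul : ∀ k (g : Ω → ℝ), Measurable[pastSigma r.T W k] g → Integrable g μ →
      Integrable (fun ω => g ω * levelTerm r Ψ x P l (fun t => W l k t ω) (θ l k ω)) μ ∧
      ∫ ω, g ω * levelTerm r Ψ x P l (fun t => W l k t ω) (θ l k ω) ∂μ =
        (∫ ω, g ω ∂μ) * levelMean q r Ψ x P l := by
    intro k g hg hgi
    have hgm : Measurable g := hg.mono (hle k) le_rfl
    have hYm : Measurable fun ω => (g ω, θ l k ω) := hgm.prodMk (hθm k)
    have hYi : IndepFun (fun ω => (g ω, θ l k ω)) (H k) μ :=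
      hindep k _ (hg.prodMk (hθmeas l k))
    have hZ' : Measurable fun z : (ℝ × E q) × (Fin q → Fin (r.steps l) → ℝ) =>
        gridTerm r Ψ x P l z.1.2 z.2 :=
      measurable_gridTerm hΨ r x hP l (measurable_snd.comp measurable_fst) measurable_snd
    have hFm : Measurable fun z : (ℝ × E q) × (Fin q → Fin (r.steps l) → ℝ) =>
        z.1.1 * gridTerm r Ψ x P l z.1.2 z.2 :=
      Measurable.mul (measurable_fst.comp measurable_fst) hZ'
    have hae : (fun ω => g ω * levelTerm r Ψ x P l (fun t => W l k t ω) (θ l k ω)) =ᵐ[μ]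
        fun ω => g ω * gridTerm r Ψ x P l (θ l k ω) (H k ω) := by
      filter_upwards [hlt k] with ω hω
      rw [hω]
    have hInteg : Integrable (fun ω => g ω * gridTerm r Ψ x P l (θ l k ω) (H k ω)) μ := by
      have hme : Measurable fun ω => g ω * gridTerm r Ψ x P l (θ l k ω) (H k ω) :=
        hgm.mul (measurable_gridTerm hΨ r x hP l (hθm k) (hHm' k))
      refine ⟨hme.aestronglyMeasurable, ?_⟩
      rw [hasFiniteIntegral_iff_norm]
      have e := IndepFun.lintegral_prodMk hYm (hHm' k) hYi
        (F := fun z => ENNReal.ofReal ‖z.1.1 * gridTerm r Ψ x P l z.1.2 z.2‖)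
        hFm.norm.ennreal_ofReal
      simp only at e
      rw [e, hHlaw]
      -- With the past frozen, Girsanov makes the inner integral independent of the parameter; the
      -- product is therefore integrable although `g` is merely in `L¹`.
      have e2 : ∀ ω, ∫⁻ v, ENNReal.ofReal ‖g ω * gridTerm r Ψ x P l (θ l k ω) v‖ ∂γ =
          ENNReal.ofReal ‖g ω‖ * ∫⁻ v, ENNReal.ofReal |gridPayoff r Ψ x P l v| ∂γ := by
        intro ω
        rw [← lintegral_ofReal_gridTerm hT hM hm hΨ hP l (θ l k ω) (φ := fun y => |y|)
          (by fun_prop) (fun a b hb => by rw [abs_mul, abs_of_pos hb]),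
          ← lintegral_const_mul' _ _ ENNReal.ofReal_ne_top]
        refine lintegral_congr fun v => ?_
        rw [norm_mul, ENNReal.ofReal_mul (norm_nonneg _), Real.norm_eq_abs (gridTerm _ _ _ _ _ _ _)]
      simp only [e2]
      rw [lintegral_mul_const' _ _ hGabs.ne]
      have := hgi.2
      rw [hasFiniteIntegral_iff_norm] at this
      exact ENNReal.mul_lt_top this hGabs
    refine ⟨hInteg.congr hae.symm, ?_⟩
    rw [integral_congr_ae hae]
    have e := IndepFun.integral_prodMk hYm (hHm' k) hYi hFm hInteg
    simp only at e
    rw [e, hHlaw, ← integral_mul_const]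
    refine integral_congr_ae (.of_forall fun ω => ?_)
    simp only
    rw [integral_const_mul, integral_gridTerm hT hM hm hΨ hP l (θ l k ω) hGi]
    rfl
  refine ⟨hmono, hle, hDm, hDpow, fun k => ?_, fun k g hg hgi => ?_, fun k g hg hgi => ?_⟩
  · refine (integral_mono (hDpow k) (hDbound k) (hDle k)).trans ?_
    rw [integral_const_mul, integral_add (hZpow k).1 (integrable_const _)]
    have := (hZpow k).2
    simp only [integral_const, probReal_univ, one_smul]
    linarith
  · simp only [mul_sub]
    exact (hmul k g hg hgi).1.sub (hgi.mul_const _)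
  · simp only [mul_sub]
    rw [integral_sub (hmul k g hg hgi).1 (hgi.mul_const _), (hmul k g hg hgi).2,
      integral_mul_const, sub_self]

end Increments

/-! ### The level payoffs driven by the reference Brownian motion -/

section Reference

variable {Ω : Type*} {d q : ℕ} {r : Params} {Ψ : ℝ → E d → E q → E d} {x : E d} {P : E d → ℝ}

/-- The bridge by which the error assumptions on `B` become statements about the Gaussian grid
measure. -/
lemma gridPayoff_gridIncr (hT : 0 < r.T) (hM : 2 ≤ r.M) (hm : 1 ≤ r.m) (B : ℝ≥0 → Ω → E q)
    (l : ℕ) (ω : Ω) :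
    gridPayoff r Ψ x P l (gridIncr (r.steps l) (r.mesh l) fun t => B t ω) =
      if l = 0 then approxPayoff r Ψ x P B (r.M ^ 0) ω
        else approxPayoff r Ψ x P B (r.M ^ l) ω - approxPayoff r Ψ x P B (r.M ^ (l - 1)) ω := by
  have h := levelPayoff_eq_gridPayoff hT hM hm Ψ x P l (fun t => B t ω) 0
  have h0 : gridShift (r.mesh l) (0 : E q) (gridIncr (r.steps l) (r.mesh l) fun t => B t ω) =
      gridIncr (r.steps l) (r.mesh l) fun t => B t ω := by
    ext j i
    simp [gridShift]
  rw [h0] at h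
  rw [← h]
  rfl

variable [mΩ : MeasurableSpace Ω] {μ : Measure Ω}

lemma measurable_approxPayoff (hΨ : ∀ h : ℝ, Measurable (Function.uncurry (Ψ h)))
    (hP : Measurable P) {B : ℝ≥0 → Ω → E q} (hB : ∀ t, Measurable (B t)) (n : ℕ) :
    Measurable (approxPayoff r Ψ x P B n) :=
  hP.comp (measurable_schemeEnd hΨ r.T x measurable_const _ fun t _ => hB t)

lemma StrongError.lintegral_sq_le [IsProbabilityMeasure μ] (hT : 0 < r.T) (hm : 1 ≤ r.m)
    (hβ : 0 < r.β) {B : ℝ≥0 → Ω → E q} {X : ℝ≥0 → Ω → E d} {p V : ℝ} (hp : 2 ≤ p) (hV : 0 < V)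
    (h : StrongError r Ψ x P B X μ p V) {n : ℕ} (hn : 1 ≤ n) :
    ∫⁻ ω, ENNReal.ofReal ((approxPayoff r Ψ x P B n ω - P (X r.T ω)) ^ 2) ∂μ ≤
      1 + ENNReal.ofReal (V * r.hbar ^ (r.β * p / 2)) := by
  have hh := Params.hbar_pos hT hm
  have hn' : (1 : ℝ) ≤ n := by exact_mod_cast hn
  calc _ ≤ ∫⁻ ω, (1 + ‖approxPayoff r Ψ x P B n ω - P (X r.T ω)‖ₑ ^ p) ∂μ :=
        lintegral_mono fun ω => ofReal_sq_le_one_add_enorm_rpow hp _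
    _ = 1 + ∫⁻ ω, ‖approxPayoff r Ψ x P B n ω - P (X r.T ω)‖ₑ ^ p ∂μ := by
        rw [lintegral_add_left measurable_const]; simp
    _ ≤ _ := by
        refine add_le_add le_rfl ((h n hn).trans (ENNReal.ofReal_le_ofReal ?_))
        gcongr
        exact div_le_self hh.le hn'

lemma MemLp.lintegral_sq_lt_top [IsProbabilityMeasure μ] {f : Ω → ℝ} {p : ℝ} (hp : 2 ≤ p)
    (h : MemLp f (ENNReal.ofReal p) μ) : ∫⁻ ω, ENNReal.ofReal (f ω ^ 2) ∂μ < ∞ := by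
  have h2 : MemLp f 2 μ := h.mono_exponent (by
    rw [← ENNReal.ofReal_ofNat 2]; exact ENNReal.ofReal_le_ofReal hp)
  have h3 := h2.integrable_sq.2
  rwa [hasFiniteIntegral_iff_ofReal (.of_forall fun ω => sq_nonneg _)] at h3

/-- The payoffs of the schemes have uniformly bounded second moments. -/
lemma exists_lintegral_sq_approxPayoff_le [IsProbabilityMeasure μ] (hT : 0 < r.T) (hm : 1 ≤ r.m)
    (hβ : 0 < r.β) (hP : Measurable P) (hΨ : ∀ h : ℝ, Measurable (Function.uncurry (Ψ h)))
    {B : ℝ≥0 → Ω → E q} (hB : ∀ t, Measurable (B t)) {X : ℝ≥0 → Ω → E d}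
    (hX : Measurable (X r.T)) {p V : ℝ} (hp : 2 ≤ p) (hV : 0 < V)
    (hLp : MemLp (fun ω => P (X r.T ω)) (ENNReal.ofReal p) μ)
    (h : StrongError r Ψ x P B X μ p V) :
    ∃ C : ℝ≥0, ∀ n : ℕ, 1 ≤ n →
      ∫⁻ ω, ENNReal.ofReal (approxPayoff r Ψ x P B n ω ^ 2) ∂μ ≤ C := by
  set b : ℝ≥0∞ := 2 * (1 + ENNReal.ofReal (V * r.hbar ^ (r.β * p / 2))) +
    2 * ∫⁻ ω, ENNReal.ofReal (P (X r.T ω) ^ 2) ∂μ with hb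
  have hbtop : b ≠ ∞ := by
    have h1 := (MemLp.lintegral_sq_lt_top hp hLp).ne
    rw [hb]
    finiteness
  refine ⟨b.toNNReal, fun n hn => ?_⟩
  rw [ENNReal.coe_toNNReal hbtop]
  -- The scheme payoff is written as strong error plus exact payoff, both bounded in `L²`.
  have h1 := lintegral_sq_sub_le μ (f := fun ω => approxPayoff r Ψ x P B n ω - P (X r.T ω))
    (g := fun ω => -P (X r.T ω))
    ((measurable_approxPayoff hΨ hP hB n).sub (hP.comp hX))
  simp only [sub_neg_eq_add, sub_add_cancel, neg_sq] at h1
  refine h1.trans ?_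
  rw [hb]
  gcongr
  exact h.lintegral_sq_le hT hm hβ hp hV hn

lemma exists_lintegral_sq_gridPayoff_le [IsProbabilityMeasure μ] (hT : 0 < r.T) (hM : 2 ≤ r.M)
    (hm : 1 ≤ r.m) (hP : Measurable P) (hΨ : ∀ h : ℝ, Measurable (Function.uncurry (Ψ h)))
    {B : ℝ≥0 → Ω → E q} (hB : IsBrownianMotion B μ)
    (h : ∃ C : ℝ≥0, ∀ n : ℕ, 1 ≤ n →
      ∫⁻ ω, ENNReal.ofReal (approxPayoff r Ψ x P B n ω ^ 2) ∂μ ≤ C) :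
    ∃ C : ℝ≥0, ∀ l : ℕ, ∫⁻ v, ENNReal.ofReal (gridPayoff r Ψ x P l v ^ 2)
      ∂gridMeasure q (r.steps l) (r.mesh l) ≤ C := by
  obtain ⟨C, hC⟩ := h
  refine ⟨2 * C + 2 * C, fun l => ?_⟩
  have hMl : ∀ l, 1 ≤ r.M ^ l := fun l => Nat.one_le_pow _ _ (by omega)
  have hHm : Measurable fun ω => gridIncr (r.steps l) (r.mesh l) fun t => B t ω :=
    measurable_gridIncr (T := r.T) (Params.steps_mul_mesh hM hm l).le fun t _ => hB.measurable t
  rw [← hB.map_gridIncr, lintegral_map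
    ((measurable_gridPayoff hΨ r x hP l).pow_const 2).ennreal_ofReal hHm]
  simp only [gridPayoff_gridIncr hT hM hm]
  push_cast
  split_ifs
  · refine (hC _ (hMl 0)).trans ?_
    rw [← two_mul, ← mul_assoc]
    exact le_mul_of_one_le_left zero_le (by norm_num)
  · refine (lintegral_sq_sub_le μ (measurable_approxPayoff hΨ hP hB.measurable _)).trans ?_
    gcongr
    · exact hC _ (hMl l)
    · exact hC _ (hMl (l - 1))

lemma levelMean_eq [IsProbabilityMeasure μ] (hT : 0 < r.T) (hM : 2 ≤ r.M)
    (hm : 1 ≤ r.m) (hP : Measurable P) (hΨ : ∀ h : ℝ, Measurable (Function.uncurry (Ψ h)))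
    {B : ℝ≥0 → Ω → E q} (hB : IsBrownianMotion B μ)
    (h : ∃ C : ℝ≥0, ∀ n : ℕ, 1 ≤ n →
      ∫⁻ ω, ENNReal.ofReal (approxPayoff r Ψ x P B n ω ^ 2) ∂μ ≤ C) (l : ℕ) :
    levelMean q r Ψ x P l = if l = 0 then ∫ ω, approxPayoff r Ψ x P B (r.M ^ 0) ω ∂μ
      else ∫ ω, approxPayoff r Ψ x P B (r.M ^ l) ω ∂μ -
        ∫ ω, approxPayoff r Ψ x P B (r.M ^ (l - 1)) ω ∂μ := by
  obtain ⟨C, hC⟩ := h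
  have hInteg : ∀ l, Integrable (approxPayoff r Ψ x P B (r.M ^ l)) μ := fun l =>
    integrable_of_lintegral_sq (measurable_approxPayoff hΨ hP hB.measurable _)
      ((hC _ (Nat.one_le_pow _ _ (by omega))).trans_lt ENNReal.coe_lt_top)
  have hHm : Measurable fun ω => gridIncr (r.steps l) (r.mesh l) fun t => B t ω :=
    measurable_gridIncr (T := r.T) (Params.steps_mul_mesh hM hm l).le fun t _ => hB.measurable t
  rw [levelMean, ← hB.map_gridIncr, integral_map hHm.aemeasurable
    (measurable_gridPayoff hΨ r x hP l).aestronglyMeasurable]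
  simp only [gridPayoff_gridIncr hT hM hm]
  split_ifs
  · rfl
  · exact integral_sub (hInteg l) (hInteg (l - 1))

lemma WeakError.tendsto (hT : 0 < r.T) (hM : 2 ≤ r.M) (hm : 1 ≤ r.m) (hα : 0 < r.α)
    {B : ℝ≥0 → Ω → E q} {X : ℝ≥0 → Ω → E d} (h : WeakError r Ψ x P B X μ) :
    Tendsto (fun l : ℕ => ∫ ω, approxPayoff r Ψ x P B (r.M ^ l) ω ∂μ) atTop
      (𝓝 (∫ ω, P (X r.T ω) ∂μ)) := by
  obtain ⟨c, hc⟩ := h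
  obtain ⟨η, hη, hexp⟩ := hc 1 le_rfl
  have hh := Params.hbar_pos hT hm
  have hM0 : (0 : ℝ) < r.M := by exact_mod_cast (by omega : 0 < r.M)
  have hstep : Tendsto (fun l : ℕ => r.hbar / ((r.M ^ l : ℕ) : ℝ)) atTop (𝓝[>] 0) := by
    refine tendsto_nhdsWithin_iff.2 ⟨?_, .of_forall fun l => ?_⟩
    · refine Tendsto.const_div_atTop ?_ _
      exact tendsto_natCast_atTop_atTop.comp (tendsto_pow_atTop_atTop_of_one_lt (by omega))
    · have : (0 : ℝ) < ((r.M ^ l : ℕ) : ℝ) := by push_cast; positivity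
      exact div_pos hh this
  have hpow : Tendsto (fun l : ℕ => (r.hbar / ((r.M ^ l : ℕ) : ℝ)) ^ (r.α * (1 : ℕ))) atTop
      (𝓝 0) := by
    have h1 : Tendsto (fun y : ℝ => y ^ (r.α * (1 : ℕ))) (𝓝 0) (𝓝 0) := by
      have := (Real.continuousAt_rpow_const 0 (r.α * (1 : ℕ))
        (Or.inr (by simpa using hα.le))).tendsto
      rwa [Real.zero_rpow (by simpa using hα.ne')] at this
    exact h1.comp (tendsto_nhdsWithin_iff.1 hstep).1
  have hlim := ((hpow.const_mul (c 1)).add (hpow.mul (hη.comp hstep))).add_const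
    (∫ ω, P (X r.T ω) ∂μ)
  simp only [mul_zero, add_zero, zero_add] at hlim
  refine hlim.congr fun l => ?_
  have := hexp (r.M ^ l) (Nat.one_le_pow _ _ (by omega))
  simp only [Finset.Icc_self, Finset.sum_singleton] at this
  rw [Function.comp_apply, ← this]
  ring

end Reference

/-! ### Convergence of the estimator -/

section Convergence

/-- Raising to the power `2/3` sends `b³` to `b²` and `9/8` to `3/4`. -/
lemma abs_le_of_absPow_le {y a b c : ℝ} (ha : 0 < a) (hb : 0 < b) (hc : 1 ≤ c)
    (h : absPow y ≤ a * b ^ 3 * (c + 1) ^ (9 / 8 : ℝ)) :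
    |y| ≤ a ^ (2 / 3 : ℝ) * b ^ 2 * (2 * c ^ (3 / 4 : ℝ)) := by
  have h1 : |y| = absPow y ^ (2 / 3 : ℝ) := by
    rw [absPow, ← Real.rpow_mul (abs_nonneg y)]; norm_num
  have h2 : (c + 1) ^ (3 / 4 : ℝ) ≤ 2 * c ^ (3 / 4 : ℝ) := by
    calc (c + 1) ^ (3 / 4 : ℝ) ≤ (2 * c) ^ (3 / 4 : ℝ) :=
          Real.rpow_le_rpow (by linarith) (by linarith) (by norm_num)
      _ = 2 ^ (3 / 4 : ℝ) * c ^ (3 / 4 : ℝ) := Real.mul_rpow (by norm_num) (by linarith)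
      _ ≤ 2 ^ (1 : ℝ) * c ^ (3 / 4 : ℝ) := by
          gcongr
          · norm_num
          · norm_num
      _ = _ := by rw [Real.rpow_one]
  rw [h1]
  calc absPow y ^ (2 / 3 : ℝ) ≤ (a * b ^ 3 * (c + 1) ^ (9 / 8 : ℝ)) ^ (2 / 3 : ℝ) :=
        Real.rpow_le_rpow (absPow_nonneg y) h (by norm_num)
    _ = a ^ (2 / 3 : ℝ) * b ^ 2 * (c + 1) ^ (3 / 4 : ℝ) := by
        rw [Real.mul_rpow (by positivity) (by positivity), Real.mul_rpow ha.le (by positivity),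
          ← Real.rpow_natCast b 3, ← Real.rpow_mul hb.le, ← Real.rpow_mul (by linarith)]
        norm_num
    _ ≤ _ := by gcongr

/-- The fluctuation of a level, for a sample size bounded below in terms of the weight. -/
lemma weight_div_mul_rpow_le {w N C s : ℝ} (hw : 0 < w) (hs : 0 < s)
    (hC : 1 ≤ C) (hwC : w ≤ C) (hN : w * s ≤ N) :
    w / N * N ^ (3 / 4 : ℝ) ≤ C * s ^ (-(1 / 4) : ℝ) := by
  have hN0 : 0 < N := lt_of_lt_of_le (by positivity) hN
  have h1 : w / N * N ^ (3 / 4 : ℝ) = w * N ^ (-(1 / 4) : ℝ) := by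
    rw [div_mul_eq_mul_div, mul_div_assoc]
    congr 1
    nth_rewrite 2 [← Real.rpow_one N]
    rw [← Real.rpow_sub hN0]
    norm_num
  have h2 : N ^ (-(1 / 4) : ℝ) ≤ (w * s) ^ (-(1 / 4) : ℝ) :=
    Real.rpow_le_rpow_of_nonpos (by positivity) hN (by norm_num)
  rw [h1]
  calc w * N ^ (-(1 / 4) : ℝ) ≤ w * (w * s) ^ (-(1 / 4) : ℝ) := by gcongr
    _ = w ^ (3 / 4 : ℝ) * s ^ (-(1 / 4) : ℝ) := by
        rw [Real.mul_rpow hw.le hs.le, ← mul_assoc]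
        congr 1
        nth_rewrite 1 [← Real.rpow_one w]
        rw [← Real.rpow_add hw]
        norm_num
    _ ≤ C * s ^ (-(1 / 4) : ℝ) := by
        gcongr
        calc w ^ (3 / 4 : ℝ) ≤ C ^ (3 / 4 : ℝ) := by gcongr
          _ ≤ C ^ (1 : ℝ) := Real.rpow_le_rpow_of_exponent_le hC (by norm_num)
          _ = C := Real.rpow_one C

/-- Deterministic part of the convergence: an array of sums that grow at most like the power `3/4`
of their length, uniformly up to a polynomial factor in the level. -/
lemma tendsto_sum_cumWeight_mul {r : Params} (hT : 0 < r.T) (hM : 2 ≤ r.M) (hm : 1 ≤ r.m)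
    (hα : 0 < r.α) (hβ : 0 < r.β) (hV₁ : 0 < r.V₁) (hA : 0 < r.A) (hvar : 0 < r.varP)
    {S : ℕ → ℕ → ℝ} {R : ℝ} (hR : 0 < R)
    (hS : ∀ l n : ℕ, absPow (S l n) ≤ R * ((l : ℝ) + 1) ^ 3 * ((n : ℝ) + 1) ^ (9 / 8 : ℝ)) :
    Tendsto (fun ε => ∑ l ∈ Finset.range (r.numLevels ε),
      cumWeight r.α r.M (r.numLevels ε) l / (r.levelN ε l : ℝ) * S l (r.levelN ε l))
      (𝓝[>] 0) (𝓝 0) := by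
  obtain ⟨C, hC1, hC⟩ := exists_abs_cumWeight_le hα hM
  obtain ⟨c, κ, hc, hκ, hN⟩ := Params.exists_le_levelN hT hM hm hα hβ hV₁ hvar
  -- The exponent adds up `2` from `(l+1)² ≤ e^(2l)`, `1` from the number of levels `L ≤ e^L`, and
  -- `κ/4` from the sample size raised to `-1/4`.
  obtain ⟨K, hK, hexp⟩ := Params.exists_exp_numLevels_le hM hα hA (r := r)
    (κ := 3 + κ / 4) (by positivity)
  set B : ℝ := R ^ (2 / 3 : ℝ) * 2 * (C * c ^ (-(1 / 4) : ℝ)) with hB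
  have hB0 : 0 ≤ B := by positivity
  have hlim : Tendsto (fun ε : ℝ => B * K * ε ^ (1 / 4 : ℝ)) (𝓝[>] 0) (𝓝 0) := by
    have h1 : Tendsto (fun y : ℝ => y ^ (1 / 4 : ℝ)) (𝓝 0) (𝓝 0) := by
      have := (Real.continuousAt_rpow_const 0 (1 / 4 : ℝ) (Or.inr (by norm_num))).tendsto
      rwa [Real.zero_rpow (by norm_num)] at this
    simpa using (h1.mono_left nhdsWithin_le_nhds).const_mul (B * K)
  refine squeeze_zero_norm' ?_ hlim
  filter_upwards [self_mem_nhdsWithin, nhdsWithin_le_nhds (Iic_mem_nhds zero_lt_one),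
    (Params.tendsto_numLevels hM hα hA).eventually (eventually_gt_atTop 0)] with ε hε hε1 hL
  replace hε : 0 < ε := hε
  set L := r.numLevels ε with hLdef
  have hterm : ∀ l ∈ Finset.range L,
      ‖cumWeight r.α r.M L l / (r.levelN ε l : ℝ) * S l (r.levelN ε l)‖ ≤
        B * ε ^ (1 / 2 : ℝ) * Real.exp ((2 + κ / 4) * L) := by
    intro l hl
    have hlL : (l : ℝ) ≤ L := by exact_mod_cast (Finset.mem_range.1 hl).le
    -- A vanishing weight makes the lower bound on the sample size void, but then the term vanishes
    -- too.
    by_cases hw : cumWeight r.α r.M L l = 0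
    · rw [hw, zero_div, zero_mul, norm_zero]
      positivity
    have hw0 : 0 < |cumWeight r.α r.M L l| := abs_pos.2 hw
    have hNl := hN ε hε hL l
    set s : ℝ := c * Real.exp (-(κ * l)) / ε ^ 2 with hs
    have hs0 : 0 < s := by positivity
    have hNl' : |cumWeight r.α r.M L l| * s ≤ r.levelN ε l := by
      refine le_of_eq_of_le ?_ hNl
      rw [hs]; ring
    have hNpos : (0 : ℝ) < r.levelN ε l := lt_of_lt_of_le (by positivity) hNl'
    have hN1 : (1 : ℝ) ≤ r.levelN ε l := by
      have : 0 < r.levelN ε l := by exact_mod_cast hNpos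
      exact_mod_cast this
    have hSb := abs_le_of_absPow_le hR (by positivity) hN1 (hS l (r.levelN ε l))
    have hwb := weight_div_mul_rpow_le hw0 hs0 hC1 (hC L l) hNl'
    have hspow : s ^ (-(1 / 4) : ℝ) =
        c ^ (-(1 / 4) : ℝ) * Real.exp (κ / 4 * l) * ε ^ (1 / 2 : ℝ) := by
      rw [hs, Real.div_rpow (by positivity) (by positivity),
        Real.mul_rpow hc.le (Real.exp_pos _).le, ← Real.exp_mul, ← Real.rpow_natCast ε 2,
        ← Real.rpow_mul hε.le, div_eq_mul_inv, ← Real.rpow_neg hε.le]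
      congr 2
      · congr 1; ring
      · norm_num
    have hl2 : ((l : ℝ) + 1) ^ 2 ≤ Real.exp (2 * l) := by
      calc ((l : ℝ) + 1) ^ 2 ≤ Real.exp l ^ 2 := by
            gcongr
            exact Real.add_one_le_exp _
        _ = Real.exp (2 * l) := by rw [← Real.exp_nat_mul]; norm_num
    rw [norm_mul, norm_div, Real.norm_eq_abs, Real.norm_eq_abs, Real.norm_eq_abs,
      abs_of_pos hNpos]
    calc |cumWeight r.α r.M L l| / (r.levelN ε l : ℝ) * |S l (r.levelN ε l)|
        ≤ |cumWeight r.α r.M L l| / (r.levelN ε l : ℝ) * (R ^ (2 / 3 : ℝ) * ((l : ℝ) + 1) ^ 2 *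
            (2 * (r.levelN ε l : ℝ) ^ (3 / 4 : ℝ))) := by gcongr
      _ = R ^ (2 / 3 : ℝ) * 2 * ((l : ℝ) + 1) ^ 2 *
            (|cumWeight r.α r.M L l| / (r.levelN ε l : ℝ) *
              (r.levelN ε l : ℝ) ^ (3 / 4 : ℝ)) := by ring
      _ ≤ R ^ (2 / 3 : ℝ) * 2 * Real.exp (2 * l) * (C * s ^ (-(1 / 4) : ℝ)) := by gcongr
      _ = B * ε ^ (1 / 2 : ℝ) * (Real.exp (2 * l) * Real.exp (κ / 4 * l)) := by
          rw [hspow, hB]; ring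
      _ = B * ε ^ (1 / 2 : ℝ) * Real.exp ((2 + κ / 4) * l) := by
          rw [← Real.exp_add]; congr 2; ring
      _ ≤ _ := by gcongr
  refine (norm_sum_le_of_le _ hterm).trans ?_
  rw [Finset.sum_const, Finset.card_range, nsmul_eq_mul]
  have hLexp : (L : ℝ) ≤ Real.exp L := by
    have := Real.add_one_le_exp (L : ℝ)
    linarith
  calc (L : ℝ) * (B * ε ^ (1 / 2 : ℝ) * Real.exp ((2 + κ / 4) * L))
      ≤ Real.exp L * (B * ε ^ (1 / 2 : ℝ) * Real.exp ((2 + κ / 4) * L)) := by gcongr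
    _ = B * ε ^ (1 / 2 : ℝ) * (Real.exp L * Real.exp ((2 + κ / 4) * L)) := by ring
    _ = B * ε ^ (1 / 2 : ℝ) * Real.exp ((3 + κ / 4) * L) := by
        rw [← Real.exp_add]; congr 2; ring
    _ ≤ B * ε ^ (1 / 2 : ℝ) * (K * ε ^ (-(1 / 4) : ℝ)) := by
        gcongr
        exact hexp ε hε hε1
    _ = B * K * (ε ^ (1 / 2 : ℝ) * ε ^ (-(1 / 4) : ℝ)) := by ring
    _ = B * K * ε ^ (1 / 4 : ℝ) := by
        rw [← Real.rpow_add hε]; norm_num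

lemma estimator_eq {Ω : Type*} {d q : ℕ} {r : Params} (hT : 0 < r.T) (hM : 2 ≤ r.M)
    (hm : 1 ≤ r.m) (hα : 0 < r.α) (hβ : 0 < r.β) (hV₁ : 0 < r.V₁) (hvar : 0 < r.varP)
    (Ψ : ℝ → E d → E q → E d) (x : E d) (P : E d → ℝ) (W : ℕ → ℕ → ℝ≥0 → Ω → E q)
    (θ : ℕ → ℕ → Ω → E q) {ε : ℝ} (hε : 0 < ε) (hL : 0 < r.numLevels ε) (ω : Ω) (a : ℕ → ℝ) :
    estimator r Ψ x P W θ ε ω =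
      ∑ l ∈ Finset.range (r.numLevels ε), cumWeight r.α r.M (r.numLevels ε) l * a l +
      ∑ l ∈ Finset.range (r.numLevels ε),
        cumWeight r.α r.M (r.numLevels ε) l / (r.levelN ε l : ℝ) *
          ∑ k ∈ Finset.range (r.levelN ε l),
            (levelTerm r Ψ x P l (fun t => W l k t ω) (θ l k ω) - a l) := by
  obtain ⟨c, κ, hc, hκ, hN⟩ := Params.exists_le_levelN hT hM hm hα hβ hV₁ hvar
  have h1 : estimator r Ψ x P W θ ε ω = ∑ l ∈ Finset.range (r.numLevels ε),
      cumWeight r.α r.M (r.numLevels ε) l / (r.levelN ε l : ℝ) *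
        ∑ k ∈ Finset.range (r.levelN ε l),
          levelTerm r Ψ x P l (fun t => W l k t ω) (θ l k ω) := by
    rw [Finset.range_eq_Ico, Finset.sum_eq_sum_Ico_succ_bot hL, cumWeight_zero hα hM hL]
    rfl
  rw [h1, ← Finset.sum_add_distrib]
  refine Finset.sum_congr rfl fun l _ => ?_
  rw [Finset.sum_sub_distrib, Finset.sum_const, Finset.card_range, nsmul_eq_mul]
  -- An empty level would lose its centering term; the lower bound shows that this happens only when
  -- its weight is zero.
  rcases Nat.eq_zero_or_pos (r.levelN ε l) with h0 | h0
  · have h2 := hN ε hε hL l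
    rw [h0, Nat.cast_zero] at h2
    have h3 : cumWeight r.α r.M (r.numLevels ε) l = 0 := by
      by_contra hne
      have := abs_pos.2 hne
      have : 0 < c * |cumWeight r.α r.M (r.numLevels ε) l| * Real.exp (-(κ * l)) / ε ^ 2 := by
        positivity
      linarith
    simp [h3]
  · have : (r.levelN ε l : ℝ) ≠ 0 := by exact_mod_cast h0.ne'
    field_simp
    ring

lemma tendsto_nhdsGT_zero_of_summable_rpow {ε : ℕ → ℝ} (hε : ∀ k, 0 < ε k) {p : ℝ} (hp : 0 < p)
    (h : Summable fun k => ε k ^ p) : Tendsto ε atTop (𝓝[>] 0) := by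
  refine tendsto_nhdsWithin_iff.2 ⟨?_, .of_forall hε⟩
  have h1 := (Real.continuousAt_rpow_const 0 (1 / p) (Or.inr (by positivity))).tendsto.comp
    h.tendsto_atTop_zero
  rw [Real.zero_rpow (by positivity)] at h1
  refine h1.congr fun k => ?_
  rw [Function.comp_apply, ← Real.rpow_mul (hε k).le, mul_one_div_cancel hp.ne', Real.rpow_one]

end Convergence

end AISML2R

end

/-! ### Combination of bias and fluctuation. -/

open AISML2R in
theorem theorem4 {Ω : Type*} [mΩ : MeasurableSpace Ω] (μ : Measure Ω) [IsProbabilityMeasure μ]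
    {d q : ℕ} (r : Params)
    (hT : 0 < r.T) (hM : 2 ≤ r.M) (hm : 1 ≤ r.m) (hα : 0 < r.α) (hβ : 0 < r.β)
    (hV₁ : 0 < r.V₁) (hc : 0 < r.c) (hA : 0 < r.A)
    -- the stochastic differential equation and its solution
    (b : E d → E d) (σ : Fin q → E d → E d) (x : E d)
    (hLip : ∃ K : ℝ, 0 < K ∧ ∀ y z : E d,
      ‖b y - b z‖ + ∑ j, ‖σ j y - σ j z‖ ≤ K * ‖y - z‖)
    (𝓕 : Filtration ℝ≥0 mΩ) (B : ℝ≥0 → Ω → E q) (hB : IsFBrownianMotion 𝓕 B μ)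
    (X : ℝ≥0 → Ω → E d) (hX : IsSDESolution r.T b σ x 𝓕 B X μ)
    -- the payoff and the discretization scheme
    (P : E d → ℝ) (hP : Measurable P)
    (Ψ : ℝ → E d → E q → E d) (hΨ : ∀ h : ℝ, Measurable (Function.uncurry (Ψ h)))
    (hvar : r.varP = Var[fun ω => P (X r.T ω); μ]) (hvar_pos : 0 < r.varP)
    -- the independent sample paths, and the adaptive parameters
    (W : ℕ → ℕ → ℝ≥0 → Ω → E q) (hW : ∀ l k, IsBrownianMotion (W l k) μ)
    (hWindep : iIndep (fun i : ℕ × ℕ => pathSigma r.T (W i.1 i.2)) μ)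
    (Θ : Set (E q)) (hΘ : IsCompact Θ)
    (θ : ℕ → ℕ → Ω → E q) (hθmem : ∀ l k ω, θ l k ω ∈ Θ)
    (hθmeas : ∀ l k, Measurable[pastSigma r.T W k] (θ l k))
    (θstar : ℕ → E q) (hθstar : ∀ l, θstar l ∈ Θ)
    (hθlim : ∀ l, ∀ᵐ ω ∂μ, Tendsto (fun k => θ l k ω) atTop (𝓝 (θstar l)))
    -- the error assumptions
    (p : ℝ) (hp : 2 ≤ p)
    (hweak : WeakError r Ψ x P B X μ)
    (hLp : MemLp (fun ω => P (X r.T ω)) (ENNReal.ofReal p) μ)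
    (V : ℝ) (hV : 0 < V) (hstrong : StrongError r Ψ x P B X μ p V)
    -- the accuracies
    (ε : ℕ → ℝ) (hε : ∀ k, 0 < ε k) (hεsum : Summable fun k => ε k ^ p) :
    ∀ᵐ ω ∂μ, Tendsto (fun k => estimator r Ψ x P W θ (ε k) ω) atTop
      (𝓝 (∫ ω', P (X r.T ω') ∂μ)) := by
  have hBm := hB.toIsBrownianMotion
  have hXm : Measurable (X r.T) := (hX.adapted r.T le_rfl).mono (𝓕.le r.T) le_rfl
  have hsq := exists_lintegral_sq_approxPayoff_le hT hm hβ hP hΨ hBm.measurable hXm hp hV hLp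
    hstrong
  obtain ⟨C₂, hC₂⟩ := exists_lintegral_sq_gridPayoff_le hT hM hm hP hΨ hBm hsq
  obtain ⟨K, hK⟩ := hΘ.isBounded.exists_norm_le
  have hmart := fun l => isMartingaleIncrement_levelTerm hT hM hm hΨ hP hW hWindep
    (fun l k ω => hK _ (hθmem l k ω)) hθmeas l (hC₂ l)
  have hmean : Tendsto (fun ε => ∑ l ∈ Finset.range (r.numLevels ε),
      cumWeight r.α r.M (r.numLevels ε) l * levelMean q r Ψ x P l) (𝓝[>] 0)
      (𝓝 (∫ ω', P (X r.T ω') ∂μ)) := by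
    refine ((tendsto_sum_weight_mul hα hM (hweak.tendsto hT hM hm hα)).comp
      (Params.tendsto_numLevels hM hα hA)).congr fun ε => ?_
    rw [Function.comp_apply, ← sum_cumWeight_mul_diff _
      fun l => ∫ ω, approxPayoff r Ψ x P B (r.M ^ l) ω ∂μ]
    simp only [levelMean_eq hT hM hm hP hΨ hBm hsq]
  filter_upwards [ae_exists_absPow_sum_le hmart] with ω ⟨R, hR, hω⟩
  have hfluct := tendsto_sum_cumWeight_mul hT hM hm hα hβ hV₁ hA hvar_pos hR hω
  have hlim := hmean.add hfluct
  rw [add_zero] at hlim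
  -- For fixed `ω` the limit is taken along all `ε → 0+`; the exceptional null set does not depend
  -- on the sequence of accuracies.
  refine Tendsto.comp (g := fun ε => estimator r Ψ x P W θ ε ω) (hlim.congr' ?_)
    (tendsto_nhdsGT_zero_of_summable_rpow hε (by linarith) hεsum)
  filter_upwards [self_mem_nhdsWithin,
    (Params.tendsto_numLevels hM hα hA).eventually (eventually_gt_atTop 0)] with ε hε hL
  exact (estimator_eq hT hM hm hα hβ hV₁ hvar_pos Ψ x P W θ hε hL ω _).symm
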